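/- **Setting.** Let $\Gamma:\mathbb{R}\to\mathbb{R}^3$ be an injective $C^2$ curve with $|\dot\Gamma|=1$, carrying a global differentiable orthonormal frame $(t,n,b)$, $t=\dot\Gamma$, which satisfies the Frenet formulas $\dot t=\gamma n$, $\dot n=-\gamma t+\tau b$, $\dot b=-\tau n$ with functions $\gamma$ (curvature, possibly with sign) and $\tau$ (torsion); more generally, $(n,b)$ may be glued from local Frenet pairs rotated by constant angles, i.e. the Frenet formulas hold for $(t,\ \cos\beta\, n+\sin\beta\, b,\ -\sin\beta\, n+\cos\beta\, b)$ with $\beta$ locally constant where $\gamma\neq0$ (precisely: $\dot t=\gamma(\cos\beta\,n+\sin\beta\,b)$, $\dot n=-\gamma\cos\beta\,t+\tau b$, $\dot b=-\gamma\sin\beta\,t-\tau n$). Assume that * either $\gamma$ and $\tau$ vanish outside some interval $[-s_0,s_0]$, or $\Gamma$ is $C^4$, $\tau$ is $C^1$ with $\tau,\dot\tau$ bounded, and $\gamma$ is $C^2$ with $\gamma,\dot\gamma,\ddot\gamma\to0$ as $|s|\to\infty$; * $|\Gamma(s)-\Gamma(s')|\to\infty$ as $|s-s'|\to\infty$. Let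 $M\subset\mathbb{R}^2$ be open and precompact with $0\in M$, let $\alpha:\mathbb{R}\to\mathbb{R}$ satisfy $\dot\alpha=\tau$, and assume that the map $$x(s,r,\theta)=\Gamma(s)-r\big[n(s)\cos(\theta-\alpha(s))+b(s)\sin(\theta-\alpha(s))\big]$$ is injective on $\mathbb{R}\times M$ ($(r,\theta)$ being polar coordinates of the points of $M$). Let $0\le V\in L^\infty(\mathbb{R}^2)$ be nonzero and vanish a.e. outside $M$, and put $\tilde V(x(s,r,\theta))=V(r,\theta)$ on the tube $x(\mathbb{R}\times M)$ and $\tilde V=0$ elsewhere in $\mathbb{R}^3$. Let $-\Delta$ be the Laplacian in $L^2(\mathbb{R}^3)$ with domain $H^2(\mathbb{R}^3)$, let $H_{\Gamma,V}=-\Delta-\tilde V$ with the same domain, and for $z\in\mathbb{C}\setminus[0,\infty)$ let $$K_{\Gamma,V}(z)=\tilde V^{1/2}(-\Delta-z)^{-1}\tilde V^{1/2}\quad\text{in } L^2(\mathbb{R}^3).$$ The discrete spectrum $\sigma_{\mathrm{disc}}$ consists of the isolated points of the spectrum that are eigenvalues of finite (algebraic) multiplicity. **Proposition.** The function $\tilde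 V$ belongs to $L^\infty(\mathbb{R}^3)$, every $z\in\mathbb{C}\setminus[0,\infty)$ lies in the resolvent set of $-\Delta$ (so that $K_{\Gamma,V}(z)$ is a well-defined bounded operator), and the following holds. 1. For every $z\in\mathbb{C}\setminus[0,\infty)$: $z\in\sigma_{\mathrm{disc}}(H_{\Gamma,V})$ if and only if $1\in\sigma_{\mathrm{disc}}(K_{\Gamma,V}(z))$. 2. The function $\kappa\mapsto K_{\Gamma,V}(-\kappa^2)$ is continuous on $(0,\infty)$ in the operator norm. 3. It is strictly decreasing on $(0,\infty)$ with respect to the order of bounded self-adjoint operators ($A\le B$ iff $B-A$ is positive); moreover, if $0<\kappa_1<\kappa_2$, then $(\psi,K_{\Gamma,V}(-\kappa_2^2)\psi)<(\psi,K_{\Gamma,V}(-\kappa_1^2)\psi)$ for every $\psi\in L^2(\mathbb{R}^3)$ with $\tilde V^{1/2}\psi\ne0$. 4. $\|K_{\Gamma,V}(-\kappa^2)\|\le\kappa^{-2}\|V\|_\infty$ for all $\kappa>0$; in particular $\|K_{\Gamma,V}(-\kappa^2)\|\to0$ as $\kappa\to\infty$. -/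

import Mathlib

open MeasureTheory TemperedDistribution Filter Topology
open scoped ENNReal Laplacian SchwartzMap

noncomputable section

namespace SoftWaveguide

abbrev E2 : Type := EuclideanSpace ℝ (Fin 2)

abbrev E3 : Type := EuclideanSpace ℝ (Fin 3)

/-- The Hilbert space `L²(ℝ³)` of complex-valued functions. -/
abbrev L2 : Type := Lp ℂ 2 (volume : Measure E3)

/-! ### Spectral notions for (possibly unbounded) operators -/

section Spectral

variable {X : Type*} [NormedAddCommGroup X] [InnerProductSpace ℂ X]

/-- `R` is a bounded two-sided inverse of `T - z`, where `T` is an operator with domain. -/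
def IsResolventAt (T : X →ₗ.[ℂ] X) (z : ℂ) (R : X →L[ℂ] X) : Prop :=
  (∀ f : X, ∃ h : R f ∈ T.domain, T ⟨R f, h⟩ - z • R f = f) ∧
    ∀ u : T.domain, R (T u - z • (u : X)) = u

def resolventSetOf (T : X →ₗ.[ℂ] X) : Set ℂ :=
  {z | ∃ R : X →L[ℂ] X, IsResolventAt T z R}

def spectrumOf (T : X →ₗ.[ℂ] X) : Set ℂ :=
  (resolventSetOf T)ᶜ

open Classical in
/-- `(T - z)⁻¹` for `z` in the resolvent set (and `0` for other `z`). -/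
def resolventOf (T : X →ₗ.[ℂ] X) (z : ℂ) : X →L[ℂ] X :=
  if h : ∃ R : X →L[ℂ] X, IsResolventAt T z R then h.choose else 0

/-- `T - z` as a linear map on the domain of `T`. -/
def shifted (T : X →ₗ.[ℂ] X) (z : ℂ) : T.domain →ₗ[ℂ] X :=
  T.toFun - z • T.domain.subtype

/-- The discrete spectrum: isolated points `z` of the spectrum that are eigenvalues of finite
multiplicity, with `T - z` of closed range. The last clause holds automatically at an isolated point
of the spectrum of a self-adjoint operator; for a general closed operator it makes the definition
equivalent to finiteness of the algebraic multiplicity (the rank of the Riesz projection). -/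
def discreteSpectrum (T : X →ₗ.[ℂ] X) : Set ℂ :=
  {z | z ∈ spectrumOf T ∧ (∀ᶠ w in 𝓝[≠] z, w ∈ resolventSetOf T) ∧
    LinearMap.ker (shifted T z) ≠ ⊥ ∧
    FiniteDimensional ℂ (LinearMap.ker (shifted T z)) ∧
    IsClosed (LinearMap.range (shifted T z) : Set X)}

/-- A bounded operator, seen as an operator whose domain is the whole space. -/
def ofBounded (K : X →L[ℂ] X) : X →ₗ.[ℂ] X :=
  (K : X →ₗ[ℂ] X).toPMap ⊤

end Spectral

/-! ### The Laplacian and multiplication operators -/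

/-- The embedding of `L²(ℝ³)` into the tempered distributions. -/
def toDist : L2 →L[ℂ] 𝓢'(E3, ℂ) :=
  Lp.toTemperedDistributionCLM ℂ volume 2

theorem toDist_injective : Function.Injective toDist :=
  LinearMap.ker_eq_bot.mp (Lp.ker_toTemperedDistributionCLM_eq_bot (F := ℂ) (μ := volume) (p := 2))

/-- The Sobolev space `H²(ℝ³)` as a subspace of `L²(ℝ³)`. -/
def sobolevH2 : Submodule ℂ L2 where
  carrier := {u | MemSobolev 2 2 (toDist u)}
  add_mem' {u v} hu hv := by
    change MemSobolev 2 2 (toDist (u + v))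
    rw [map_add]
    exact MemSobolev.add hu hv
  zero_mem' := by
    change MemSobolev 2 2 (toDist 0)
    rw [map_zero]
    exact memSobolev_fun_zero E3 ℂ 2 2
  smul_mem' c u hu := by
    change MemSobolev 2 2 (toDist (c • u))
    rw [map_smul]
    exact MemSobolev.smul c hu

theorem exists_neg_laplacian (u : sobolevH2) : ∃ w : L2, toDist w = -Δ (toDist (u : L2)) := by
  have hu : MemSobolev 2 2 (toDist (u : L2)) := u.2
  have h := hu.laplacian.neg
  rw [sub_self, memSobolev_zero_iff] at h
  obtain ⟨w, hw⟩ := h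
  exact ⟨w, hw.symm⟩

/-- The operator `-Δ` in `L²(ℝ³)` with domain `H²(ℝ³)`; `Δ` is the distributional Laplacian. -/
def negLaplacian : L2 →ₗ.[ℂ] L2 where
  domain := sobolevH2
  toFun :=
    { toFun := fun u => (exists_neg_laplacian u).choose
      map_add' := fun u v => toDist_injective <| by
        rw [map_add, (exists_neg_laplacian (u + v)).choose_spec,
          (exists_neg_laplacian u).choose_spec, (exists_neg_laplacian v).choose_spec]
        simp only [← laplacianCLM_apply, Submodule.coe_add, map_add]
        abel
      map_smul' := fun c u => toDist_injective <| by
        rw [map_smul, (exists_neg_laplacian (c • u)).choose_spec,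
          (exists_neg_laplacian u).choose_spec]
        simp only [← laplacianCLM_apply, Submodule.coe_smul, map_smul, RingHom.id_apply, smul_neg] }

open Classical in
/-- Multiplication by a function `g ∈ L^∞(ℝ³)`, as a bounded operator in `L²(ℝ³)`
(and `0` if `g` is not in `L^∞`). -/
def mulOp (g : E3 → ℝ) : L2 →L[ℂ] L2 :=
  if h : MemLp (fun x => (g x : ℂ)) ∞ (volume : Measure E3) then
    (ContinuousLinearMap.mul ℂ ℂ).holderL volume ∞ 2 2 (h.toLp _)
  else 0

/-! ### The tube and its potential -/

/-- The data of a soft waveguide: an arc-length parametrized curve `Γ` with normal vectors `n`, `b`,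
curvature `γ` and torsion `τ`; the angle `β` by which the Frenet triad is rotated with respect to
`(n, b)` (see `Data.Admissible`); the twist angle `α` of the cross section; the cross section `M`
and the profile `V` of the potential. -/
structure Data where
  Γ : ℝ → E3
  n : ℝ → E3
  b : ℝ → E3
  γ : ℝ → ℝ
  τ : ℝ → ℝ
  β : ℝ → ℝ
  α : ℝ → ℝ
  M : Set E2
  V : E2 → ℝ

namespace Data

variable (D : Data)

/-- The map `x` from `ℝ × M` to the tube, in Cartesian coordinates `y = (r cos θ, r sin θ)` of the
cross section: `r cos (θ - α)` and `r sin (θ - α)` are the coefficients of `n` and `b`. -/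
def tubeMap (p : ℝ × E2) : E3 :=
  D.Γ p.1 - ((p.2 0 * Real.cos (D.α p.1) + p.2 1 * Real.sin (D.α p.1)) • D.n p.1 +
    (p.2 1 * Real.cos (D.α p.1) - p.2 0 * Real.sin (D.α p.1)) • D.b p.1)

theorem tubeMap_polar (s r θ : ℝ) :
    D.tubeMap (s, !₂[r * Real.cos θ, r * Real.sin θ]) =
      D.Γ s - r • (Real.cos (θ - D.α s) • D.n s + Real.sin (θ - D.α s) • D.b s) := by
  simp only [tubeMap, Real.cos_sub, Real.sin_sub, smul_add, smul_smul]
  congr 3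
  · simp; ring
  · simp; ring

/-- The standing assumptions. The Frenet triad of `Γ` is `(Γ', N, B)` with
`N = cos β • n + sin β • b` and `B = -sin β • n + cos β • b`, where `β` is locally constant wherever
`γ ≠ 0`: the globally defined pair `(n, b)` is obtained by gluing local Frenet triads rotated by
constant angles. For `β = 0` the equations are the Frenet formulas themselves. -/
structure Admissible : Prop where
  contDiff : ContDiff ℝ 2 D.Γ
  injective : Function.Injective D.Γ
  unit_speed : ∀ s, ‖deriv D.Γ s‖ = 1
  orthonormal : ∀ s, Orthonormal ℝ ![deriv D.Γ s, D.n s, D.b s]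
  frenet_t : ∀ s, HasDerivAt (deriv D.Γ)
    (D.γ s • (Real.cos (D.β s) • D.n s + Real.sin (D.β s) • D.b s)) s
  frenet_n : ∀ s, HasDerivAt D.n
    (-(D.γ s * Real.cos (D.β s)) • deriv D.Γ s + D.τ s • D.b s) s
  frenet_b : ∀ s, HasDerivAt D.b
    (-(D.γ s * Real.sin (D.β s)) • deriv D.Γ s - D.τ s • D.n s) s
  rotation : ∀ s, D.γ s ≠ 0 → ∀ᶠ s' in 𝓝 s, D.β s' = D.β s
  /-- `Γ` is straight outside a compact set, or asymptotically straight. -/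
  straight :
    (∃ s₀ > 0, ∀ s, s₀ < |s| → D.γ s = 0 ∧ D.τ s = 0) ∨
    (ContDiff ℝ 4 D.Γ ∧ ContDiff ℝ 1 D.τ ∧ ContDiff ℝ 2 D.γ ∧
      (∃ C, ∀ s, |D.τ s| ≤ C ∧ |deriv D.τ s| ≤ C) ∧
      Tendsto D.γ (cocompact ℝ) (𝓝 0) ∧
      Tendsto (deriv D.γ) (cocompact ℝ) (𝓝 0) ∧
      Tendsto (deriv (deriv D.γ)) (cocompact ℝ) (𝓝 0))
  /-- `|Γ(s) - Γ(s')| → ∞` as `|s - s'| → ∞`. -/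
  separation : ∀ R : ℝ, ∃ L : ℝ, ∀ s s', L ≤ |s - s'| → R ≤ ‖D.Γ s - D.Γ s'‖
  isOpen : IsOpen D.M
  precompact : IsCompact (closure D.M)
  zero_mem : (0 : E2) ∈ D.M
  injOn : Set.InjOn D.tubeMap (Set.univ ×ˢ D.M)
  /-- The Tang condition. -/
  tang : ∀ s, HasDerivAt D.α (D.τ s) s
  memLp : MemLp D.V ∞ volume
  nonneg : 0 ≤ᵐ[volume] D.V
  nonzero : ¬ D.V =ᵐ[volume] 0
  /-- `V` vanishes (almost everywhere) outside `M`. -/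
  support : ∀ᵐ y, y ∉ D.M → D.V y = 0

open Classical in
/-- The potential `Ṽ` on `ℝ³`: `Ṽ (x (s, y)) = V y` on the tube `x (ℝ × M)`, and `0` elsewhere. -/
def potential (p : E3) : ℝ :=
  if h : ∃ q : ℝ × E2, q.2 ∈ D.M ∧ D.tubeMap q = p then D.V h.choose.2 else 0

/-- `Ṽ^{1/2}` as a multiplication operator. -/
def sqrtPotentialOp : L2 →L[ℂ] L2 :=
  mulOp fun x => √(D.potential x)

/-- `H = -Δ - Ṽ` with domain `H²(ℝ³)`. -/
def hamiltonian : L2 →ₗ.[ℂ] L2 :=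
  (-(mulOp D.potential : L2 →ₗ[ℂ] L2)) +ᵥ negLaplacian

/-- The Birman–Schwinger operator `K(z) = Ṽ^{1/2} (-Δ - z)⁻¹ Ṽ^{1/2}`. -/
def birmanSchwinger (z : ℂ) : L2 →L[ℂ] L2 :=
  D.sqrtPotentialOp ∘L resolventOf negLaplacian z ∘L D.sqrtPotentialOp

end Data

end SoftWaveguide

end

noncomputable section

namespace SoftWaveguide

/-! ### Resolvents and factorizations of operators with domain -/

section AbstractOperators

variable {X : Type*} [NormedAddCommGroup X] [InnerProductSpace ℂ X]

/-! Write `T` for `-Δ`, `A` for multiplication by the square root of the potential, and `R = (T -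
z)⁻¹`. On the domain, `T - A² - z = (1 - A · AR)(T - z)` with `T - z` bijective, so the left side
and `1 - A · AR` have isomorphic kernels and the same range. Exchanging the factors `A` and `AR`
turns the latter into `1 - ARA = 1 - K(z)`, again with isomorphic kernel and with closedness of the
range preserved (`isEigenFredholm_perturb_iff`). This matches every clause in the definition of the
discrete spectrum except isolation.

Isolation is automatic in the self-adjoint setting: if a self-adjoint bounded operator has closed
range, then it is invertible off its kernel, so `0` is at most an isolated point of its spectrum
(`eventually_isUnit_sub_of_isClosed_range`). For real `z` this applies to `1 - K(z)`, and to the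
Hamiltonian through one of its resolvents at a real point. For non-real `z` both sides are false,
since symmetric operators have real eigenvalues.

Continuity, monotonicity and the norm bound come from the first resolvent identity and from `T ≥ 0`.
The facts about `-Δ` are read off from its resolvent at `-4π²`, a multiple of a Bessel potential and
hence a Fourier multiplier.

The geometry enters only in showing that the potential is measurable, essentially bounded by the
profile, and not a.e. zero. The tube map is differentiable, so it preserves null sets; it is
injective and continuous on a Borel set, so it is a measurable embedding there; and far out, where
the curvature is small, its derivative is injective, so it does not crush sets of positive measure.
-/

theorem IsResolventAt.unique {T : X →ₗ.[ℂ] X} {z : ℂ} {R R' : X →L[ℂ] X}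
    (h : IsResolventAt T z R) (h' : IsResolventAt T z R') : R = R' := by
  ext f
  obtain ⟨hm, he⟩ := h.1 f
  have := h'.2 ⟨R f, hm⟩
  rw [he] at this
  exact this.symm

theorem IsResolventAt.resolventOf_eq {T : X →ₗ.[ℂ] X} {z : ℂ} {R : X →L[ℂ] X}
    (h : IsResolventAt T z R) : resolventOf T z = R := by
  have hex : ∃ R : X →L[ℂ] X, IsResolventAt T z R := ⟨R, h⟩
  rw [resolventOf, dif_pos hex]
  exact hex.choose_spec.unique h

theorem isResolventAt_resolventOf {T : X →ₗ.[ℂ] X} {z : ℂ} (h : z ∈ resolventSetOf T) :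
    IsResolventAt T z (resolventOf T z) := by
  obtain ⟨R, hR⟩ := h
  rwa [hR.resolventOf_eq]

theorem shifted_apply (T : X →ₗ.[ℂ] X) (z : ℂ) (u : T.domain) :
    shifted T z u = T u - z • (u : X) := rfl

theorem IsResolventAt.ker_eq_bot {T : X →ₗ.[ℂ] X} {z : ℂ} {R : X →L[ℂ] X}
    (h : IsResolventAt T z R) : LinearMap.ker (shifted T z) = ⊥ := by
  rw [LinearMap.ker_eq_bot']
  intro u hu
  have := h.2 u
  rw [← shifted_apply, hu, map_zero] at this
  exact Subtype.ext this.symm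

/-- The operator `S - w` is obtained from `T - z` by composing with the bounded operator `C`. -/
def Factors (S : X →ₗ.[ℂ] X) (w : ℂ) (C : X →L[ℂ] X) (T : X →ₗ.[ℂ] X) (z : ℂ) : Prop :=
  S.domain = T.domain ∧
    ∀ (u : X) (h : u ∈ S.domain) (h' : u ∈ T.domain),
      S ⟨u, h⟩ - w • u = C (T ⟨u, h'⟩ - z • u)

section Factor

variable {S T : X →ₗ.[ℂ] X} {w z : ℂ} {C R : X →L[ℂ] X}

theorem Factors.apply_resolvent (hF : Factors S w C T z) (hR : IsResolventAt T z R) (f : X)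
    (h : R f ∈ S.domain) : S ⟨R f, h⟩ - w • R f = C f := by
  obtain ⟨hm, he⟩ := hR.1 f
  rw [hF.2 (R f) h hm, he]

theorem Factors.resolvent_mem (hF : Factors S w C T z) (hR : IsResolventAt T z R) (f : X) :
    R f ∈ S.domain := by
  rw [hF.1]
  exact (hR.1 f).1

/-- From `S - w = C (T - z)` the inverse is `R C⁻¹`. -/
theorem Factors.isResolventAt (hF : Factors S w C T z) (hR : IsResolventAt T z R)
    {B : X →L[ℂ] X} (hCB : C * B = 1) (hBC : B * C = 1) : IsResolventAt S w (R ∘L B) := by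
  refine ⟨fun f => ⟨hF.resolvent_mem hR _, ?_⟩, fun u => ?_⟩
  · exact (hF.apply_resolvent hR (B f) (hF.resolvent_mem hR _)).trans (DFunLike.congr_fun hCB f)
  · have hu : (u : X) ∈ T.domain := hF.1 ▸ u.2
    have h1 := hF.2 u u.2 hu
    rw [Subtype.coe_eta] at h1
    have h2 : B (C (T ⟨u, hu⟩ - z • (u : X))) = _ := DFunLike.congr_fun hBC _
    rw [h1, ContinuousLinearMap.comp_apply, h2, one_apply_eq_self]
    exact hR.2 ⟨u, hu⟩

theorem Factors.mem_resolventSetOf (hF : Factors S w C T z) (hR : IsResolventAt T z R)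
    (hC : IsUnit C) : w ∈ resolventSetOf S := by
  obtain ⟨U, rfl⟩ := hC
  exact ⟨_, hF.isResolventAt hR U.mul_inv U.inv_mul⟩

/-- `T - z` is onto, so composing it with `C` does not shrink the range of `C`. -/
theorem Factors.range_eq (hF : Factors S w C T z) (hR : IsResolventAt T z R) :
    (LinearMap.range (shifted S w) : Set X) = LinearMap.range (C : X →ₗ[ℂ] X) := by
  ext y
  constructor
  · rintro ⟨u, rfl⟩
    exact ⟨_, (hF.2 u u.2 (hF.1 ▸ u.2)).symm⟩
  · rintro ⟨f, rfl⟩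
    exact ⟨⟨R f, hF.resolvent_mem hR f⟩, hF.apply_resolvent hR f _⟩

/-- The kernels of `S - w` and of the factor `C` are isomorphic. -/
def Factors.kerEquiv (hF : Factors S w C T z) (hR : IsResolventAt T z R) :
    LinearMap.ker (C : X →ₗ[ℂ] X) ≃ₗ[ℂ] LinearMap.ker (shifted S w) :=
  LinearEquiv.ofBijective
    (LinearMap.codRestrict (LinearMap.ker (shifted S w))
      (LinearMap.codRestrict S.domain
        ((R : X →ₗ[ℂ] X) ∘ₗ (LinearMap.ker (C : X →ₗ[ℂ] X)).subtype)
        (fun f => hF.resolvent_mem hR f))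
      (fun f => by
        rw [LinearMap.mem_ker, shifted_apply]
        exact (hF.apply_resolvent hR f _).trans f.2)) (by
    constructor
    · intro f g hfg
      have h0 : R f = R g := congrArg (fun x => ((x : S.domain) : X)) (congrArg Subtype.val hfg)
      obtain ⟨hm, he⟩ := hR.1 f
      obtain ⟨hm', he'⟩ := hR.1 g
      apply Subtype.ext
      rw [← he, ← he']
      exact congrArg (shifted T z) (Subtype.ext h0 : (⟨R f, hm⟩ : T.domain) = ⟨R g, hm'⟩)
    · rintro ⟨u, hu⟩
      have huT : (u : X) ∈ T.domain := hF.1 ▸ u.2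
      refine ⟨⟨T ⟨u, huT⟩ - z • (u : X), ?_⟩, ?_⟩
      · rw [LinearMap.mem_ker]
        exact (hF.2 u u.2 huT).symm.trans hu
      · exact Subtype.ext (Subtype.ext (hR.2 ⟨u, huT⟩)))

end Factor

/-- On the domain `u = R (T - a) u`, so the difference `(z - a) u` can be written with `T - a`
factored out on the right. -/
theorem factors_shift {T : X →ₗ.[ℂ] X} {a : ℂ} {R : X →L[ℂ] X} (hR : IsResolventAt T a R) (z : ℂ) :
    Factors T z (1 - (z - a) • R) T a := by
  refine ⟨rfl, fun u h h' => ?_⟩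
  have := hR.2 ⟨u, h⟩
  simp only at this
  simp only [sub_apply, one_apply_eq_self,
    smul_apply, this]
  module

theorem factors_perturb {T : X →ₗ.[ℂ] X} {z : ℂ} {R : X →L[ℂ] X} (hR : IsResolventAt T z R)
    (W : X →L[ℂ] X) :
    Factors ((-(W : X →ₗ[ℂ] X)) +ᵥ T) z (1 - W * R) T z := by
  refine ⟨rfl, fun u h h' => ?_⟩
  have := hR.2 ⟨u, h'⟩
  simp only at this
  simp only [sub_apply, one_apply_eq_self,
    mul_apply_eq_comp, this]
  rw [LinearPMap.vadd_apply]
  simp only [LinearMap.neg_apply, ContinuousLinearMap.coe_coe]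
  abel

/-- The first resolvent identity: apply `R (T - z) = 1` to the vector `Q f`. -/
theorem IsResolventAt.sub_eq {T : X →ₗ.[ℂ] X} {z w : ℂ} {R Q : X →L[ℂ] X}
    (hR : IsResolventAt T z R) (hQ : IsResolventAt T w Q) : R - Q = (z - w) • (R * Q) := by
  ext f
  obtain ⟨hm, he⟩ := hQ.1 f
  have h := hR.2 ⟨Q f, hm⟩
  have h2 : T ⟨Q f, hm⟩ - z • Q f = f - (z - w) • Q f := by
    nth_rewrite 3 [← he]
    module
  simp only [h2, map_sub, map_smul] at h
  simp only [sub_apply, smul_apply,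
    mul_apply_eq_comp]
  rw [sub_eq_iff_eq_add, ← sub_eq_iff_eq_add']
  exact h

/-! ### Bounded self-adjoint operators with closed range -/

/-- Zero is at most an isolated point of the spectrum of a self-adjoint operator of closed range. -/
theorem eventually_isUnit_sub_of_isClosed_range [CompleteSpace X] {S : X →L[ℂ] X}
    (hS : IsSelfAdjoint S) (hcl : IsClosed (LinearMap.range (S : X →ₗ[ℂ] X) : Set X)) :
    ∀ᶠ c in 𝓝[≠] (0 : ℂ), IsUnit (S - c • (1 : X →L[ℂ] X)) := by
  set N : Submodule ℂ X := LinearMap.ker (S : X →ₗ[ℂ] X) with hN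
  have hNcl : IsClosed (N : Set X) := S.isClosed_ker
  have : CompleteSpace N := hNcl.completeSpace_coe
  set P : X →L[ℂ] X := N.starProjection with hP
  -- For self-adjoint `S` the orthogonal complement of the kernel is the closure of the range; here
  -- the closure is superfluous.
  have hrange : Nᗮ = LinearMap.range (S : X →ₗ[ℂ] X) := by
    have h1 := ContinuousLinearMap.orthogonal_range S
    rw [ContinuousLinearMap.isSelfAdjoint_iff'.mp hS] at h1
    rw [hN]
    change (S.ker)ᗮ = S.range
    rw [← h1, Submodule.orthogonal_orthogonal_eq_closure]
    exact IsClosed.submodule_topologicalClosure_eq hcl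
  have hSP : S * P = 0 := by
    ext x
    exact (N.starProjection_apply_mem x : S _ = 0)
  have hPS : P * S = 0 := by
    ext x
    have : S x ∈ Nᗮ := by rw [hrange]; exact ⟨x, rfl⟩
    exact (Submodule.starProjection_apply_eq_zero_iff N).mpr this
  have hPP : P * P = P := N.isIdempotentElem_starProjection
  -- `S` is bijective on `Nᗮ` and `P` is the identity on `N`, so filling in the kernel gives an
  -- invertible operator.
  have hunit : IsUnit (S + P) := by
    rw [ContinuousLinearMap.isUnit_iff_bijective]
    constructor
    · rw [injective_iff_map_eq_zero]
      intro x hx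
      have h1 : P x = 0 := by
        have := congrArg P hx
        simp only [add_apply, map_add, map_zero] at this
        have a : P (S x) = 0 := DFunLike.congr_fun hPS x
        have b : P (P x) = P x := DFunLike.congr_fun hPP x
        rwa [a, b, zero_add] at this
      have h2 : x ∈ N := by
        have : S x = 0 := by simpa [h1] using hx
        exact this
      rw [← h1]
      exact (Submodule.starProjection_eq_self_iff.mpr h2).symm
    · intro y
      have h1 : y - P y ∈ Nᗮ := Submodule.sub_starProjection_mem_orthogonal y
      rw [hrange] at h1
      obtain ⟨x, hx⟩ := h1
      refine ⟨x - P x + P y, ?_⟩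
      have a : ∀ v, S (P v) = 0 := fun v => DFunLike.congr_fun hSP v
      have b : ∀ v, P (P v) = P v := fun v => DFunLike.congr_fun hPP v
      have hx' : S x = y - P y := hx
      simp only [add_apply, map_add, map_sub, a, b, hx']
      abel
  have hev : ∀ᶠ c in 𝓝 (0 : ℂ), IsUnit (S + P - c • (1 : X →L[ℂ] X)) := by
    have hc : Continuous fun c : ℂ => S + P - c • (1 : X →L[ℂ] X) := by fun_prop
    have := hc.tendsto 0
    simp only [zero_smul, sub_zero] at this
    exact this.eventually (Units.isOpen.mem_nhds hunit)
  filter_upwards [hev.filter_mono nhdsWithin_le_nhds, self_mem_nhdsWithin] with c hc hc0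
  have hc0' : c ≠ 0 := hc0
  obtain ⟨U, hU⟩ := hc
  have hcommP : Commute P (U : X →L[ℂ] X) := by
    rw [hU]
    simp only [Commute, SemiconjBy, mul_sub, mul_add, sub_mul, add_mul, hSP, hPS, hPP,
      mul_smul_comm, smul_mul_assoc, mul_one, one_mul]
  have hcommP' : Commute P (↑U⁻¹ : X →L[ℂ] X) := hcommP.units_inv_right
  have hdecomp : S - c • (1 : X →L[ℂ] X) = U - P := by rw [hU]; abel
  have hPQ : P * (1 - P) = 0 := by rw [mul_sub, hPP, mul_one, sub_self]
  have hQP : (1 - P) * P = 0 := by rw [sub_mul, hPP, one_mul, sub_self]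
  have hleft : (S - c • (1 : X →L[ℂ] X)) * P = -(c • P) := by
    rw [sub_mul, hSP, smul_mul_assoc, one_mul, zero_sub]
  have hright : P * (S - c • (1 : X →L[ℂ] X)) = -(c • P) := by
    rw [mul_sub, hPS, mul_smul_comm, mul_one, zero_sub]
  -- With `U = S + P - c`, the operator `S - c` agrees with `U` on `Nᗮ` and with `-c` on `N`; invert
  -- on each summand.
  refine ⟨⟨S - c • (1 : X →L[ℂ] X), (↑U⁻¹ : X →L[ℂ] X) * (1 - P) - c⁻¹ • P, ?_, ?_⟩, rfl⟩
  · rw [mul_sub, mul_smul_comm, hleft, hdecomp, sub_mul, ← mul_assoc, ← mul_assoc, U.mul_inv,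
      one_mul, hcommP'.eq, mul_assoc _ P, hPQ, mul_zero, sub_zero, smul_neg, smul_smul,
      inv_mul_cancel₀ hc0', one_smul]
    abel
  · have hcommQ : Commute (1 - P) (U : X →L[ℂ] X) := (Commute.one_left _).sub_left hcommP
    rw [sub_mul, smul_mul_assoc, hright, hdecomp, mul_assoc, mul_sub, hQP, sub_zero, hcommQ.eq,
      ← mul_assoc, U.inv_mul, one_mul, smul_neg, smul_smul, inv_mul_cancel₀ hc0', one_smul]
    abel

/-! ### Discrete spectrum -/

theorem isResolventAt_ofBounded {K B : X →L[ℂ] X} {z : ℂ}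
    (h1 : (K - z • (1 : X →L[ℂ] X)) * B = 1) (h2 : B * (K - z • (1 : X →L[ℂ] X)) = 1) :
    IsResolventAt (ofBounded K) z B :=
  ⟨fun f => ⟨Submodule.mem_top, DFunLike.congr_fun h1 f⟩, fun u => DFunLike.congr_fun h2 (u : X)⟩

theorem mem_resolventSetOf_ofBounded {K : X →L[ℂ] X} {z : ℂ}
    (h : IsUnit (K - z • (1 : X →L[ℂ] X))) : z ∈ resolventSetOf (ofBounded K) := by
  obtain ⟨U, hU⟩ := h
  exact ⟨_, isResolventAt_ofBounded (by rw [← hU, U.mul_inv]) (by rw [← hU, U.inv_mul])⟩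

theorem range_shifted_ofBounded_one (K : X →L[ℂ] X) :
    LinearMap.range (shifted (ofBounded K) 1) =
      LinearMap.range ((1 - K : X →L[ℂ] X) : X →ₗ[ℂ] X) := by
  ext y
  constructor
  · rintro ⟨u, rfl⟩
    refine ⟨-(u : X), ?_⟩
    change -(u : X) - K (-(u : X)) = K u - (1 : ℂ) • (u : X)
    rw [map_neg, one_smul]; abel
  · rintro ⟨u, rfl⟩
    refine ⟨⟨-u, Submodule.mem_top⟩, ?_⟩
    change K (-u) - (1 : ℂ) • (-u) = u - K u
    rw [map_neg, one_smul]; abel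

/-- The eigenspace of a bounded operator `K` at `1` is the kernel of `1 - K`. -/
def kerShiftedOfBoundedOne (K : X →L[ℂ] X) :
    LinearMap.ker (shifted (ofBounded K) 1) ≃ₗ[ℂ]
      LinearMap.ker ((1 - K : X →L[ℂ] X) : X →ₗ[ℂ] X) :=
  LinearEquiv.ofSubmodules (LinearEquiv.ofTop (ofBounded K).domain rfl) _ _ (by
    ext y
    simp only [Submodule.mem_map, LinearMap.mem_ker]
    constructor
    · rintro ⟨u, hu, rfl⟩
      change K (u : X) - (1 : ℂ) • (u : X) = 0 at hu
      rw [one_smul] at hu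
      change (u : X) - K u = 0
      rw [← neg_eq_zero, neg_sub, hu]
    · intro hy
      refine ⟨⟨y, Submodule.mem_top⟩, ?_, rfl⟩
      change y - K y = 0 at hy
      change K y - (1 : ℂ) • y = 0
      rw [one_smul, ← neg_eq_zero, neg_sub, hy])

/-- The kernel of `L` is a nonzero finite-dimensional space, and the range of `L` is closed. -/
def IsEigenFredholm {E : Type*} [AddCommGroup E] [Module ℂ E] (L : E →ₗ[ℂ] X) : Prop :=
  LinearMap.ker L ≠ ⊥ ∧ FiniteDimensional ℂ (LinearMap.ker L) ∧
    IsClosed (LinearMap.range L : Set X)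

theorem isEigenFredholm_congr {E F : Type*} [AddCommGroup E] [Module ℂ E] [AddCommGroup F]
    [Module ℂ F] {L : E →ₗ[ℂ] X} {L' : F →ₗ[ℂ] X} (e : LinearMap.ker L ≃ₗ[ℂ] LinearMap.ker L')
    (h : IsClosed (LinearMap.range L : Set X) ↔ IsClosed (LinearMap.range L' : Set X)) :
    IsEigenFredholm L ↔ IsEigenFredholm L' := by
  refine and_congr (not_congr ?_) (and_congr ?_ h)
  · rw [← Submodule.subsingleton_iff_eq_bot, ← Submodule.subsingleton_iff_eq_bot]
    exact e.toEquiv.subsingleton_congr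
  · exact ⟨fun _ => e.finiteDimensional, fun _ => e.symm.finiteDimensional⟩

/-- A nontrivial kernel already excludes a resolvent, so membership in the spectrum is redundant. -/
theorem mem_discreteSpectrum_iff (T : X →ₗ.[ℂ] X) (z : ℂ) :
    z ∈ discreteSpectrum T ↔
      (∀ᶠ w in 𝓝[≠] z, w ∈ resolventSetOf T) ∧ IsEigenFredholm (shifted T z) := by
  constructor
  · rintro ⟨-, h1, h2⟩
    exact ⟨h1, h2⟩
  · rintro ⟨h1, h2⟩
    exact ⟨fun ⟨R, hR⟩ => h2.1 hR.ker_eq_bot, h1, h2⟩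

/-- Closed range of the self-adjoint operator `1 - K` makes the isolation clause automatic. -/
theorem one_mem_discreteSpectrum_iff [CompleteSpace X] {K : X →L[ℂ] X} (hK : IsSelfAdjoint K) :
    (1 : ℂ) ∈ discreteSpectrum (ofBounded K) ↔
      IsEigenFredholm ((1 - K : X →L[ℂ] X) : X →ₗ[ℂ] X) := by
  rw [mem_discreteSpectrum_iff, isEigenFredholm_congr (kerShiftedOfBoundedOne K)
    (by rw [range_shifted_ofBounded_one])]
  refine and_iff_right_of_imp fun h => ?_
  have h1 := eventually_isUnit_sub_of_isClosed_range ((IsSelfAdjoint.one _).sub hK) h.2.2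
  have ht : Tendsto (fun w : ℂ => 1 - w) (𝓝[≠] 1) (𝓝[≠] 0) := by
    refine tendsto_nhdsWithin_iff.mpr ⟨?_, ?_⟩
    · have : Continuous fun w : ℂ => 1 - w := by fun_prop
      simpa using (this.tendsto 1).mono_left nhdsWithin_le_nhds
    · filter_upwards [self_mem_nhdsWithin] with w hw
      exact sub_ne_zero.mpr (Ne.symm hw)
  filter_upwards [ht.eventually h1] with w hw
  apply mem_resolventSetOf_ofBounded
  have : K - w • (1 : X →L[ℂ] X) = -(1 - K - (1 - w) • (1 : X →L[ℂ] X)) := by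
    rw [sub_smul, one_smul]; abel
  rw [this]
  exact hw.neg

/-- The unbounded counterpart: a self-adjoint resolvent `B` at a real point `a` reduces
invertibility of `T - w` to that of the bounded operator `1 - (w - a) B`. -/
theorem mem_discreteSpectrum_iff_of_isSelfAdjoint_resolvent [CompleteSpace X] {T : X →ₗ.[ℂ] X}
    {a : ℝ} {B : X →L[ℂ] X} (hB : IsResolventAt T a B) (hBs : IsSelfAdjoint B) (z : ℝ) :
    (z : ℂ) ∈ discreteSpectrum T ↔ IsEigenFredholm (shifted T z) := by
  rw [mem_discreteSpectrum_iff]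
  refine and_iff_right_of_imp fun h => ?_
  have hza : (z : ℂ) - a ≠ 0 := by
    intro h0
    rw [sub_eq_zero] at h0
    rw [h0] at h
    exact h.1 hB.ker_eq_bot
  have hF := factors_shift hB z
  have hcl := h.2.2
  rw [hF.range_eq hB] at hcl
  have hsa : IsSelfAdjoint (1 - ((z : ℂ) - a) • B) := by
    refine (IsSelfAdjoint.one _).sub (IsSelfAdjoint.smul ?_ hBs)
    simp [isSelfAdjoint_iff]
  have h1 := eventually_isUnit_sub_of_isClosed_range hsa hcl
  have ht : Tendsto (fun w : ℂ => (w - z) / (w - a)) (𝓝[≠] (z : ℂ)) (𝓝 0) := by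
    have : ContinuousAt (fun w : ℂ => (w - z) / (w - a)) (z : ℂ) :=
      ContinuousAt.div₀ (f := fun w : ℂ => w - z) (g := fun w : ℂ => w - a) (by fun_prop)
        (by fun_prop) hza
    have := this.tendsto
    simp only [sub_self, zero_div] at this
    exact this.mono_left nhdsWithin_le_nhds
  have hne : ∀ᶠ w : ℂ in 𝓝[≠] (z : ℂ), w ≠ a :=
    (eventually_ne_nhds (sub_ne_zero.mp hza)).filter_mono nhdsWithin_le_nhds
  have ht' : Tendsto (fun w : ℂ => (w - z) / (w - a)) (𝓝[≠] (z : ℂ)) (𝓝[≠] 0) := by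
    refine tendsto_nhdsWithin_iff.mpr ⟨ht, ?_⟩
    filter_upwards [self_mem_nhdsWithin, hne] with w hw hwa
    exact div_ne_zero (sub_ne_zero.mpr hw) (sub_ne_zero.mpr hwa)
  filter_upwards [ht'.eventually h1, hne] with w hw hwa
  refine (factors_shift hB w).mem_resolventSetOf hB ?_
  have hwa' : w - a ≠ 0 := sub_ne_zero.mpr hwa
  -- Up to a nonzero scalar, moving from `z` to `w` shifts the self-adjoint operator `1 - (z - a) B`
  -- by `(w - z) / (w - a)`, which tends to `0` without vanishing.
  have : 1 - (w - a) • B = ((w - a) / (z - a)) •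
      (1 - ((z : ℂ) - a) • B - ((w - z) / (w - a)) • (1 : X →L[ℂ] X)) := by
    rw [smul_sub, smul_sub, smul_smul, smul_smul, div_mul_cancel₀ _ hza]
    have : (w - a) / (z - a) * ((w - z) / (w - a)) = (w - a) / ((z : ℂ) - a) - 1 := by
      field_simp
      ring
    rw [this]
    module
  rw [this]
  exact hw.smul (Units.mk0 _ (div_ne_zero hwa' hza))

/-! ### Exchanging the factors of a product -/

/-- A vector `y` lies in the range of `1 - TS` exactly when `S y` lies in the range of `1 - ST`, so
one range is the preimage of the other under a continuous map. -/
theorem isClosed_range_one_sub_mul {S T : X →L[ℂ] X}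
    (h : IsClosed (LinearMap.range ((1 - S * T : X →L[ℂ] X) : X →ₗ[ℂ] X) : Set X)) :
    IsClosed (LinearMap.range ((1 - T * S : X →L[ℂ] X) : X →ₗ[ℂ] X) : Set X) := by
  have : (LinearMap.range ((1 - T * S : X →L[ℂ] X) : X →ₗ[ℂ] X) : Set X) =
      S ⁻¹' (LinearMap.range ((1 - S * T : X →L[ℂ] X) : X →ₗ[ℂ] X) : Set X) := by
    ext y
    constructor
    · rintro ⟨x, rfl⟩
      refine ⟨S x, ?_⟩
      change S x - S (T (S x)) = S (x - T (S x))
      rw [map_sub]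
    · rintro ⟨x, hx⟩
      change x - S (T x) = S y at hx
      -- From `x - STx = Sy`: `(1 - TS)(y + Tx) = y + T(x - Sy - STx) = y`.
      refine ⟨y + T x, ?_⟩
      change y + T x - T (S (y + T x)) = y
      have h2 := congrArg T hx
      rw [map_sub] at h2
      rw [map_add, map_add, ← h2]
      abel
  rw [this]
  exact h.preimage S.continuous

/-- The kernels of `1 - S T` and `1 - T S` are isomorphic. -/
def kerOneSubMulEquiv (S T : X →L[ℂ] X) :
    LinearMap.ker ((1 - S * T : X →L[ℂ] X) : X →ₗ[ℂ] X) ≃ₗ[ℂ]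
      LinearMap.ker ((1 - T * S : X →L[ℂ] X) : X →ₗ[ℂ] X) :=
  LinearEquiv.ofLinearMap
    (((T : X →ₗ[ℂ] X).restrict fun x hx => by
      change x - S (T x) = 0 at hx
      change T x - T (S (T x)) = 0
      rw [← map_sub, hx, map_zero]))
    (((S : X →ₗ[ℂ] X).restrict fun x hx => by
      change x - T (S x) = 0 at hx
      change S x - S (T (S x)) = 0
      rw [← map_sub, hx, map_zero]))
    (by
      ext ⟨x, hx⟩
      change x - T (S x) = 0 at hx
      change T (S x) = x
      exact (sub_eq_zero.mp hx).symm)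
    (by
      ext ⟨x, hx⟩
      change x - S (T x) = 0 at hx
      change S (T x) = x
      exact (sub_eq_zero.mp hx).symm)

theorem isEigenFredholm_one_sub_mul_comm (S T : X →L[ℂ] X) :
    IsEigenFredholm ((1 - S * T : X →L[ℂ] X) : X →ₗ[ℂ] X) ↔
      IsEigenFredholm ((1 - T * S : X →L[ℂ] X) : X →ₗ[ℂ] X) :=
  isEigenFredholm_congr (kerOneSubMulEquiv S T)
    ⟨isClosed_range_one_sub_mul, isClosed_range_one_sub_mul⟩

/-- The algebraic core of the Birman–Schwinger principle, valid without any self-adjointness: factor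
out `T - z`, then exchange `A` and `AR`. -/
theorem isEigenFredholm_perturb_iff {T : X →ₗ.[ℂ] X} {z : ℂ} {R : X →L[ℂ] X}
    (hR : IsResolventAt T z R) (A : X →L[ℂ] X) :
    IsEigenFredholm (shifted ((-((A * A : X →L[ℂ] X) : X →ₗ[ℂ] X)) +ᵥ T) z) ↔
      IsEigenFredholm ((1 - A * R * A : X →L[ℂ] X) : X →ₗ[ℂ] X) := by
  have hF := factors_perturb hR (A * A)
  rw [← isEigenFredholm_congr (hF.kerEquiv hR) (by rw [hF.range_eq hR]), mul_assoc A A R,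
    isEigenFredholm_one_sub_mul_comm]

/-! ### Symmetric and nonnegative operators -/

/-- The operator `T` with domain is symmetric. -/
def IsSymm (T : X →ₗ.[ℂ] X) : Prop :=
  ∀ u v : T.domain, inner ℂ (T u) (v : X) = inner ℂ (u : X) (T v)

theorem IsSymm.isSelfAdjoint_resolvent [CompleteSpace X] {T : X →ₗ.[ℂ] X} (hT : IsSymm T) {a : ℝ}
    {B : X →L[ℂ] X} (hB : IsResolventAt T a B) : IsSelfAdjoint B := by
  rw [ContinuousLinearMap.isSelfAdjoint_iff_isSymmetric]
  intro f g
  change inner ℂ (B f) g = inner ℂ f (B g)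
  obtain ⟨hf, ef⟩ := hB.1 f
  obtain ⟨hg, eg⟩ := hB.1 g
  have := hT ⟨B f, hf⟩ ⟨B g, hg⟩
  nth_rewrite 2 [← ef]
  nth_rewrite 1 [← eg]
  simp only at this
  rw [inner_sub_left, inner_sub_right, this, inner_smul_left, inner_smul_right]
  simp

theorem IsSymm.perturb {T : X →ₗ.[ℂ] X} (hT : IsSymm T) {W : X →L[ℂ] X}
    (hW : ∀ x y, inner ℂ (W x) y = inner ℂ x (W y)) :
    IsSymm ((-(W : X →ₗ[ℂ] X)) +ᵥ T) := by
  intro u v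
  have := hT u v
  simp only [LinearPMap.vadd_apply, LinearMap.neg_apply, ContinuousLinearMap.coe_coe,
    inner_add_left, inner_add_right, inner_neg_left, inner_neg_right, hW, this]

/-- Eigenvalues of a symmetric operator are real. -/
theorem IsSymm.im_eq_zero {T : X →ₗ.[ℂ] X} (hT : IsSymm T) {z : ℂ}
    (hz : LinearMap.ker (shifted T z) ≠ ⊥) : z.im = 0 := by
  obtain ⟨u, hu, hu0⟩ := Submodule.exists_mem_ne_zero_of_ne_bot hz
  rw [LinearMap.mem_ker, shifted_apply, sub_eq_zero] at hu
  have h := hT u u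
  rw [hu, inner_smul_left, inner_smul_right] at h
  have h0 : inner ℂ (u : X) (u : X) ≠ 0 := inner_self_ne_zero.mpr (by simpa using hu0)
  exact Complex.conj_eq_iff_im.mp (mul_right_cancel₀ h0 h)

/-- The quadratic form of the operator `T` with domain is nonnegative. -/
def IsNonneg (T : X →ₗ.[ℂ] X) : Prop :=
  ∀ u : T.domain, 0 ≤ (inner ℂ (T u) (u : X)).re

section Nonneg

variable {T : X →ₗ.[ℂ] X} {a : ℝ} {R : X →L[ℂ] X}

/-- Put `f = (T + a) R f` and drop the nonnegative term `(T R f, R f)`. -/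
theorem IsNonneg.mul_norm_sq_le (hT : IsNonneg T) (hR : IsResolventAt T ((-a : ℝ) : ℂ) R) (f : X) :
    a * ‖R f‖ ^ 2 ≤ (inner ℂ f (R f)).re := by
  obtain ⟨hf, ef⟩ := hR.1 f
  have h := hT ⟨R f, hf⟩
  simp only at h
  nth_rewrite 2 [← ef]
  rw [inner_sub_left, inner_smul_left, inner_self_eq_norm_sq_to_K]
  simp only [Complex.ofReal_neg, map_neg, Complex.conj_ofReal, neg_mul, sub_neg_eq_add,
    Complex.add_re]
  have : ((a : ℂ) * ((‖R f‖ : ℝ) : ℂ) ^ 2).re = a * ‖R f‖ ^ 2 := by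
    rw [← Complex.ofReal_pow, ← Complex.ofReal_mul, Complex.ofReal_re]
  change a * ‖R f‖ ^ 2 ≤ _ + ((a : ℂ) * ((‖R f‖ : ℝ) : ℂ) ^ 2).re
  linarith

theorem IsNonneg.norm_resolvent_le (hT : IsNonneg T) (ha : 0 < a)
    (hR : IsResolventAt T ((-a : ℝ) : ℂ) R) : ‖R‖ ≤ a⁻¹ := by
  refine ContinuousLinearMap.opNorm_le_bound _ (by positivity) fun f => ?_
  have h1 := hT.mul_norm_sq_le hR f
  have h2 : (inner ℂ f (R f)).re ≤ ‖f‖ * ‖R f‖ :=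
    (Complex.re_le_norm _).trans (norm_inner_le_norm f (R f))
  rw [inv_mul_eq_div, le_div_iff₀ ha]
  rcases (norm_nonneg (R f)).eq_or_lt with h0 | h0
  · rw [← h0, zero_mul]; positivity
  · nlinarith

/-- Using the resolvent identity twice, `R - Q = (b - a) (Q² + (b - a) Q R Q)`. The first term
contributes `‖Q f‖² > 0` because `Q` is injective, the second is nonnegative because `R` is. -/
theorem IsNonneg.re_inner_resolvent_lt [CompleteSpace X] (hT : IsNonneg T) (hs : IsSymm T)
    (ha : 0 < a) {b : ℝ} (hab : a < b) {Q : X →L[ℂ] X} (hR : IsResolventAt T ((-a : ℝ) : ℂ) R)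
    (hQ : IsResolventAt T ((-b : ℝ) : ℂ) Q) {f : X} (hf : f ≠ 0) :
    (inner ℂ f (Q f)).re < (inner ℂ f (R f)).re := by
  have hQs : ∀ x y, inner ℂ (Q x) y = inner ℂ x (Q y) := (hs.isSelfAdjoint_resolvent hQ).isSymmetric
  have hsub := hR.sub_eq hQ
  have hsub' := hQ.sub_eq hR
  have hz : ((-a : ℝ) : ℂ) - ((-b : ℝ) : ℂ) = ((b - a : ℝ) : ℂ) := by push_cast; ring
  have hz' : ((-b : ℝ) : ℂ) - ((-a : ℝ) : ℂ) = ((-(b - a) : ℝ) : ℂ) := by push_cast; ring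
  rw [hz] at hsub
  rw [hz'] at hsub'
  have hQ0 : Q f ≠ 0 := by
    intro h0
    obtain ⟨hm, e⟩ := hQ.1 f
    have : (⟨Q f, hm⟩ : T.domain) = 0 := Subtype.ext h0
    rw [this, h0, smul_zero, sub_zero, LinearPMap.map_zero] at e
    exact hf e.symm
  have e1 : R f = Q f + ((b - a : ℝ) : ℂ) • R (Q f) := by
    have := DFunLike.congr_fun hsub f
    simp only [sub_apply, smul_apply,
      mul_apply_eq_comp] at this
    rw [← this]; abel
  have e2 : R (Q f) = Q (Q f) + ((b - a : ℝ) : ℂ) • Q (R (Q f)) := by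
    have := DFunLike.congr_fun hsub' (Q f)
    simp only [sub_apply, smul_apply,
      mul_apply_eq_comp] at this
    rw [Complex.ofReal_neg, neg_smul, sub_eq_iff_eq_add, neg_add_eq_sub, eq_sub_iff_add_eq] at this
    exact this.symm
  have e3 : (inner ℂ f (R (Q f))).re =
      ‖Q f‖ ^ 2 + (b - a) * (inner ℂ (Q f) (R (Q f))).re := by
    conv_lhs => rw [e2]
    rw [inner_add_right, inner_smul_right, ← hQs f (Q f), ← hQs f (R (Q f)), Complex.add_re,
      Complex.re_ofReal_mul]
    congr 1
    exact inner_self_eq_norm_sq (𝕜 := ℂ) (Q f)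
  rw [e1, inner_add_right, inner_smul_right, Complex.add_re, Complex.re_ofReal_mul, e3]
  have h4 := hT.mul_norm_sq_le hR (Q f)
  have h5 : 0 < ‖Q f‖ := norm_pos_iff.mpr hQ0
  have h6 : 0 ≤ a * ‖R (Q f)‖ ^ 2 := by positivity
  have h7 : 0 < b - a := by linarith
  have : 0 < (b - a) * (‖Q f‖ ^ 2 + (b - a) * (inner ℂ (Q f) (R (Q f))).re) := by
    have : 0 ≤ (b - a) * (inner ℂ (Q f) (R (Q f))).re := mul_nonneg h7.le (h6.trans h4)
    positivity
  linarith

/-- The spectrum of a symmetric nonnegative operator with a resolvent at some negative number is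
contained in `[0, ∞)`. -/
theorem IsNonneg.mem_resolventSetOf [CompleteSpace X] (hT : IsNonneg T) (hs : IsSymm T)
    (ha : 0 < a) (hR : IsResolventAt T ((-a : ℝ) : ℂ) R) {z : ℂ}
    (hz : ∀ t : ℝ, 0 ≤ t → z ≠ t) : z ∈ resolventSetOf T := by
  by_cases hza : z + a = 0
  · have : z = ((-a : ℝ) : ℂ) := by push_cast; exact eq_neg_of_add_eq_zero_left hza
    rw [this]
    exact ⟨R, hR⟩
  refine (factors_shift hR z).mem_resolventSetOf hR ?_
  have hRs : IsSelfAdjoint R := hs.isSelfAdjoint_resolvent hR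
  have hRp : 0 ≤ R := by
    rw [ContinuousLinearMap.nonneg_iff_isPositive, ContinuousLinearMap.isPositive_def']
    refine ⟨hRs, fun f => ?_⟩
    have h1 := hT.mul_norm_sq_le hR f
    have h2 : 0 ≤ a * ‖R f‖ ^ 2 := by positivity
    rw [ContinuousLinearMap.reApplyInnerSelf_apply, ← inner_conj_symm, RCLike.conj_re]
    exact h2.trans h1
  -- The spectrum of `R` lies in `[0, 1/a]`. If it contained `x = (z + a)⁻¹`, then `z = x⁻¹ - a`
  -- would be real and nonnegative.
  have hmem : (z + a)⁻¹ ∉ spectrum ℂ R := by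
    intro hmem
    have hre := hRs.mem_spectrum_eq_re hmem
    have hle : ‖(z + a)⁻¹‖ ≤ a⁻¹ := by
      refine (spectrum.norm_le_norm_mul_of_mem hmem).trans ?_
      refine (mul_le_of_le_one_right (norm_nonneg R) ContinuousLinearMap.norm_id_le).trans ?_
      exact hT.norm_resolvent_le ha hR
    set x : ℝ := ((z + a)⁻¹).re
    have hxe : (z + a)⁻¹ = (x : ℂ) := hre
    have hx0 : 0 ≤ x := by
      rw [hxe] at hmem
      exact spectrum_nonneg_of_nonneg hRp ((spectrum.algebraMap_mem_iff ℂ).mp hmem)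
    rw [hxe, Complex.norm_real, Real.norm_of_nonneg hx0] at hle
    have hxpos : 0 < x := by
      refine hx0.lt_of_ne fun h => hza ?_
      rw [← h, Complex.ofReal_zero, inv_eq_zero] at hxe
      exact hxe
    refine hz (x⁻¹ - a) (sub_nonneg.mpr ((le_inv_comm₀ hxpos ha).mp hle)) ?_
    push_cast
    rw [← hxe, inv_inv]
    ring
  rw [spectrum.notMem_iff] at hmem
  have h1 : 1 - (z - ((-a : ℝ) : ℂ)) • R =
      (z + a) • (algebraMap ℂ (X →L[ℂ] X) (z + a)⁻¹ - R) := by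
    rw [smul_sub, Algebra.algebraMap_eq_smul_one, smul_smul, mul_inv_cancel₀ hza, one_smul]
    push_cast
    rw [sub_neg_eq_add]
  rw [h1]
  exact hmem.smul (Units.mk0 _ hza)

end Nonneg

/-! ### The Birman–Schwinger principle -/

theorem birmanSchwinger_principle [CompleteSpace X] {T : X →ₗ.[ℂ] X} (hT : IsNonneg T)
    (hs : IsSymm T) (hres : ∀ z : ℂ, (∀ t : ℝ, 0 ≤ t → z ≠ t) → z ∈ resolventSetOf T)
    {A : X →L[ℂ] X} (hA : IsSelfAdjoint A) {z : ℂ} (hz : ∀ t : ℝ, 0 ≤ t → z ≠ t) :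
    z ∈ discreteSpectrum ((-((A * A : X →L[ℂ] X) : X →ₗ[ℂ] X)) +ᵥ T) ↔
      (1 : ℂ) ∈ discreteSpectrum (ofBounded (A * resolventOf T z * A)) := by
  have hR := isResolventAt_resolventOf (hres z hz)
  have hAs : ∀ x y, inner ℂ (A x) y = inner ℂ x (A y) := hA.isSymmetric
  have hHs : IsSymm ((-((A * A : X →L[ℂ] X) : X →ₗ[ℂ] X)) +ᵥ T) :=
    hs.perturb fun x y => by simp only [mul_apply_eq_comp, hAs]
  have hiff := isEigenFredholm_perturb_iff hR A
  by_cases him : z.im = 0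
  · obtain ⟨x, rfl⟩ : ∃ x : ℝ, z = x := ⟨z.re, Complex.ext rfl (by simp [him])⟩
    have hRs := hs.isSelfAdjoint_resolvent hR
    have hK : IsSelfAdjoint (A * resolventOf T x * A) := by
      have := hRs.conjugate A
      rwa [hA.star_eq] at this
    rw [one_mem_discreteSpectrum_iff hK, ← hiff]
    -- At `-c` the factor `1 - A² R` is invertible by a Neumann series, since `‖R‖ ≤ c⁻¹`. This
    -- gives the perturbed operator one real resolvent point.
    set c : ℝ := ‖A * A‖ + 1
    have hc : 0 < c := by positivity
    have hRc := isResolventAt_resolventOf (hres ((-c : ℝ) : ℂ) fun t ht h => by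
      have := Complex.ofReal_injective h
      linarith)
    have hsmall : ‖A * A * resolventOf T ((-c : ℝ) : ℂ)‖ < 1 := by
      refine (norm_mul_le _ _).trans_lt ?_
      have h1 := hT.norm_resolvent_le hc hRc
      calc ‖A * A‖ * ‖resolventOf T ((-c : ℝ) : ℂ)‖ ≤ ‖A * A‖ * c⁻¹ := by gcongr
        _ < 1 := by rw [← div_eq_mul_inv, div_lt_one hc]; exact lt_add_one _
    obtain ⟨B, hB⟩ := (factors_perturb hRc (A * A)).mem_resolventSetOf hRc
      (isUnit_one_sub_of_norm_lt_one hsmall)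
    exact mem_discreteSpectrum_iff_of_isSelfAdjoint_resolvent hB (hHs.isSelfAdjoint_resolvent hB) x
  · constructor
    · intro h
      exact absurd (hHs.im_eq_zero ((mem_discreteSpectrum_iff _ _).mp h).2.1) him
    · intro h
      have h1 := ((mem_discreteSpectrum_iff _ _).mp h).2
      rw [isEigenFredholm_congr (kerShiftedOfBoundedOne _) (by rw [range_shifted_ofBounded_one]),
        ← hiff] at h1
      exact absurd (hHs.im_eq_zero h1.1) him

end AbstractOperators

/-! ### Multiplication operators on `L²` -/

section Multiplication

variable {g h : E3 → ℝ}

theorem mulOp_coeFn (hg : MemLp g ∞ volume) (f : L2) :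
    mulOp g f =ᵐ[volume] fun x => (g x : ℂ) * f x := by
  have hg' : MemLp (fun x => (g x : ℂ)) ∞ (volume : Measure E3) := hg.ofReal
  rw [mulOp, dif_pos hg', ContinuousLinearMap.holderL_apply_apply]
  filter_upwards [ContinuousLinearMap.coeFn_holder (r := 2) (ContinuousLinearMap.mul ℂ ℂ)
    (hg'.toLp _) f, hg'.coeFn_toLp] with x h1 h2
  rw [h1, h2, ContinuousLinearMap.mul_apply']

theorem mulOp_mul_mulOp (hg : MemLp g ∞ volume) (hh : MemLp h ∞ volume) {k : E3 → ℝ}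
    (hk : MemLp k ∞ volume) (hgh : ∀ᵐ x, g x * h x = k x) :
    mulOp g * mulOp h = mulOp k := by
  ext1 f
  apply Lp.ext
  rw [mul_apply_eq_comp]
  filter_upwards [mulOp_coeFn hg (mulOp h f), mulOp_coeFn hh f, mulOp_coeFn hk f, hgh]
    with x h1 h2 h3 h4
  rw [h1, h2, h3, ← h4, Complex.ofReal_mul, mul_assoc]

theorem norm_mulOp_le (hg : MemLp g ∞ volume) : ‖mulOp g‖ ≤ (eLpNorm g ∞ volume).toReal := by
  have hg' : MemLp (fun x => (g x : ℂ)) ∞ (volume : Measure E3) := hg.ofReal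
  refine ContinuousLinearMap.opNorm_le_bound _ ENNReal.toReal_nonneg fun f => ?_
  rw [mulOp, dif_pos hg', ContinuousLinearMap.holderL_apply_apply]
  refine (ContinuousLinearMap.norm_holder_apply_apply_le _ _ _).trans ?_
  rw [ContinuousLinearMap.opNorm_mul, one_mul, Lp.norm_toLp]
  refine mul_le_mul_of_nonneg_right (le_of_eq ?_) (norm_nonneg _)
  congr 1
  exact eLpNorm_congr_norm_ae (Eventually.of_forall fun x => by simp)

theorem isSelfAdjoint_mulOp (hg : MemLp g ∞ volume) : IsSelfAdjoint (mulOp g) := by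
  rw [ContinuousLinearMap.isSelfAdjoint_iff_isSymmetric]
  intro f f'
  change inner ℂ (mulOp g f) f' = inner ℂ f (mulOp g f')
  rw [L2.inner_def, L2.inner_def]
  apply integral_congr_ae
  filter_upwards [mulOp_coeFn hg f, mulOp_coeFn hg f'] with x h1 h2
  rw [h1, h2, ← smul_eq_mul, ← smul_eq_mul, inner_smul_left, inner_smul_right, Complex.conj_ofReal]

theorem re_inner_mulOp_nonneg (hg : MemLp g ∞ volume) (h0 : 0 ≤ᵐ[volume] g) (f : L2) :
    0 ≤ (inner ℂ f (mulOp g f)).re := by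
  have hintegral : Integrable (fun x => inner ℂ (f x) (mulOp g f x)) (volume : Measure E3) :=
    L2.integrable_inner f (mulOp g f)
  rw [L2.inner_def]
  refine le_of_le_of_eq ?_ (integral_re hintegral)
  refine integral_nonneg_of_ae ?_
  filter_upwards [mulOp_coeFn hg f, h0] with x h1 h2
  rw [h1, ← smul_eq_mul, inner_smul_right, inner_self_eq_norm_sq_to_K]
  simp only [Pi.zero_apply]
  have : ((g x : ℂ) * ((‖f x‖ : ℝ) : ℂ) ^ 2).re = g x * ‖f x‖ ^ 2 := by
    rw [← Complex.ofReal_pow, ← Complex.ofReal_mul, Complex.ofReal_re]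
  change 0 ≤ ((g x : ℂ) * ((‖f x‖ : ℝ) : ℂ) ^ 2).re
  rw [this]
  exact mul_nonneg h2 (by positivity)

end Multiplication

/-! ### The resolvent of the Laplacian as a Fourier multiplier -/

section Laplacian

open FourierTransform

/-- The symbol of the Bessel potential of order `-2`. -/
def besselSymbol (x : E3) : ℝ := (1 + ‖x‖ ^ 2)⁻¹

theorem besselSymbol_nonneg (x : E3) : 0 ≤ besselSymbol x := by
  unfold besselSymbol; positivity

theorem besselSymbol_le_one (x : E3) : besselSymbol x ≤ 1 :=
  inv_le_one_of_one_le₀ (by nlinarith [sq_nonneg ‖x‖])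

theorem continuous_besselSymbol : Continuous besselSymbol := by
  unfold besselSymbol
  exact Continuous.inv₀ (by fun_prop) fun x => by positivity

theorem memLp_besselSymbol : MemLp besselSymbol ∞ (volume : Measure E3) :=
  memLp_top_of_bound continuous_besselSymbol.aestronglyMeasurable 1
    (Eventually.of_forall fun x => by
      rw [Real.norm_of_nonneg (besselSymbol_nonneg x)]; exact besselSymbol_le_one x)

theorem besselSymbol_eq_rpow (x : E3) : besselSymbol x = (1 + ‖x‖ ^ 2) ^ ((-2 : ℝ) / 2) := by
  rw [besselSymbol, show (-2 : ℝ) / 2 = -1 by norm_num, Real.rpow_neg_one]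

theorem toDist_mulOp_besselSymbol (f : L2) :
    toDist (mulOp besselSymbol f) =
      smulLeftCLM ℂ (fun x : E3 => (((1 + ‖x‖ ^ 2) ^ ((-2 : ℝ) / 2) : ℝ) : ℂ)) (toDist f) := by
  have hm : MemLp (fun x : E3 => (((1 + ‖x‖ ^ 2) ^ ((-2 : ℝ) / 2) : ℝ) : ℂ)) ∞ volume := by
    have := memLp_besselSymbol.ofReal (K := ℂ)
    simp only [besselSymbol_eq_rpow] at this
    exact this
  have h := Lp.toTemperedDistribution_smul_eq (r := 2) (by fun_prop) hm f
  have e : (mulOp besselSymbol f : L2) = (hm.toLp _ • f : L2) := by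
    apply Lp.ext
    filter_upwards [mulOp_coeFn memLp_besselSymbol f, Lp.coeFn_lpSMul (r := 2) (hm.toLp _) f,
      hm.coeFn_toLp] with x h1 h2 h3
    rw [h1, h2, Pi.smul_apply', h3, besselSymbol_eq_rpow, smul_eq_mul]
  rw [e]
  exact h

/-- The Bessel potential of order `-2` on `L²(ℝ³)`. -/
def besselOp : L2 →L[ℂ] L2 :=
  ((Lp.fourierTransformₗᵢ E3 ℂ).symm : L2 →L[ℂ] L2) ∘L mulOp besselSymbol ∘L
    ((Lp.fourierTransformₗᵢ E3 ℂ) : L2 →L[ℂ] L2)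

theorem besselOp_apply (f : L2) : besselOp f = 𝓕⁻ (mulOp besselSymbol (𝓕 f)) := rfl

theorem toDist_besselOp (f : L2) : toDist (besselOp f) = besselPotential E3 ℂ (-2) (toDist f) := by
  have h1 : toDist (𝓕⁻ (mulOp besselSymbol (𝓕 f))) = 𝓕⁻ (toDist (mulOp besselSymbol (𝓕 f))) :=
    (Lp.fourierInv_toTemperedDistribution_eq _).symm
  have h2 : toDist (𝓕 f) = 𝓕 (toDist f) := (Lp.fourier_toTemperedDistribution_eq f).symm
  rw [besselOp_apply, h1, toDist_mulOp_besselSymbol, h2, besselPotential,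
    TemperedDistribution.fourierMultiplierCLM_apply]

theorem besselOp_inner (f g : L2) :
    inner ℂ (besselOp f) g = inner ℂ (mulOp besselSymbol (𝓕 f) : L2) (𝓕 g : L2) := by
  rw [besselOp_apply, ← Lp.inner_fourier_eq, FourierTransform.fourier_fourierInv_eq]

theorem besselOp_symm (f g : L2) : inner ℂ (besselOp f) g = inner ℂ f (besselOp g) := by
  rw [besselOp_inner, ← inner_conj_symm f, besselOp_inner, inner_conj_symm]
  exact (isSelfAdjoint_mulOp memLp_besselSymbol).isSymmetric _ _

/-- The symbol `m` takes values in `[0, 1]`, so `m - m² ≥ 0`; by Plancherel this becomes the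
operator inequality. It yields nonnegativity of `-Δ`. -/
theorem norm_besselOp_sq_le (f : L2) : ‖besselOp f‖ ^ 2 ≤ (inner ℂ f (besselOp f)).re := by
  set k : E3 → ℝ := fun x => besselSymbol x - besselSymbol x * besselSymbol x
  have hsq : MemLp (fun x => besselSymbol x * besselSymbol x) ∞ (volume : Measure E3) :=
    memLp_besselSymbol.mul memLp_besselSymbol
  have hk : MemLp k ∞ (volume : Measure E3) := memLp_besselSymbol.sub hsq
  have hk0 : 0 ≤ᵐ[volume] k := Eventually.of_forall fun x => by
    have h1 := besselSymbol_nonneg x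
    have h2 := besselSymbol_le_one x
    change 0 ≤ besselSymbol x - besselSymbol x * besselSymbol x
    nlinarith
  have hdecomp : ∀ v : L2, mulOp k v =
      mulOp besselSymbol v - mulOp besselSymbol (mulOp besselSymbol v) := by
    intro v
    apply Lp.ext
    filter_upwards [mulOp_coeFn hk v, mulOp_coeFn memLp_besselSymbol v,
      mulOp_coeFn memLp_besselSymbol (mulOp besselSymbol v),
      Lp.coeFn_sub (mulOp besselSymbol v) (mulOp besselSymbol (mulOp besselSymbol v))]
      with x h1 h2 h3 h4
    rw [h4, Pi.sub_apply, h1, h3, h2]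
    simp only [k]
    push_cast
    ring
  have h := re_inner_mulOp_nonneg hk hk0 (𝓕 f)
  rw [hdecomp, inner_sub_right, Complex.sub_re] at h
  have h1 : inner ℂ (𝓕 f : L2) (mulOp besselSymbol (mulOp besselSymbol (𝓕 f))) =
      inner ℂ (mulOp besselSymbol (𝓕 f)) (mulOp besselSymbol (𝓕 f)) :=
    ((isSelfAdjoint_mulOp memLp_besselSymbol).isSymmetric _ _).symm
  have h2 : ‖besselOp f‖ ^ 2 =
      (inner ℂ (mulOp besselSymbol (𝓕 f)) (mulOp besselSymbol (𝓕 f))).re := by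
    have e : ‖besselOp f‖ = ‖mulOp besselSymbol (𝓕 f)‖ := by
      rw [besselOp_apply]
      exact (Lp.fourierTransformₗᵢ E3 ℂ).symm.norm_map _
    rw [e]
    exact (inner_self_eq_norm_sq (𝕜 := ℂ) _).symm
  rw [← besselOp_symm, besselOp_inner, h2, ← h1]
  have h3 : inner ℂ (mulOp besselSymbol (𝓕 f)) (𝓕 f : L2) =
      inner ℂ (𝓕 f : L2) (mulOp besselSymbol (𝓕 f)) :=
    (isSelfAdjoint_mulOp memLp_besselSymbol).isSymmetric _ _
  rw [h3]
  linarith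

theorem toDist_negLaplacian (u : negLaplacian.domain) :
    toDist (negLaplacian u) = -Δ (toDist (u : L2)) :=
  (exists_neg_laplacian u).choose_spec

/-- `4π²`, the negative of a spectral parameter at which the resolvent is a Bessel potential. -/
def fourPiSq : ℝ := (2 * Real.pi) ^ 2

theorem fourPiSq_pos : 0 < fourPiSq := by
  unfold fourPiSq; positivity

/-- In the Fourier normalization used here `-Δ` has symbol `4π²‖x‖²`, so the shift by `4π²` produces
exactly `4π² (1 + ‖x‖²)`. -/
theorem neg_laplacian_add_eq (f : 𝓢'(E3, ℂ)) :
    -Δ f + (fourPiSq : ℂ) • f = (fourPiSq : ℂ) • besselPotential E3 ℂ 2 f := by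
  have h1 : besselPotential E3 ℂ 2 f =
      f + TemperedDistribution.fourierMultiplierCLM ℂ (fun x : E3 => Complex.ofReal (‖x‖ ^ 2)) f := by
    rw [besselPotential, TemperedDistribution.fourierMultiplierCLM_apply,
      TemperedDistribution.fourierMultiplierCLM_apply]
    have : (fun x : E3 => (((1 + ‖x‖ ^ 2) ^ ((2 : ℝ) / 2) : ℝ) : ℂ)) =
        (fun _ => (1 : ℂ)) + fun x : E3 => Complex.ofReal (‖x‖ ^ 2) := by
      ext x
      simp
    rw [this, smulLeftCLM_add (by fun_prop) (by fun_prop), add_apply, smulLeftCLM_const, one_smul,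
      FourierTransform.fourierInv_add, FourierTransform.fourierInv_fourier_eq]
  rw [h1, TemperedDistribution.laplacian_eq_fourierMultiplierCLM, smul_add]
  have : ∀ v : 𝓢'(E3, ℂ), (-(2 * Real.pi) ^ 2 : ℝ) • v = -((fourPiSq : ℂ) • v) := by
    intro v
    ext φ
    change (-(2 * Real.pi) ^ 2 : ℝ) • v φ = -((fourPiSq : ℂ) • v φ)
    rw [neg_smul, fourPiSq, Complex.coe_smul]
  rw [this, neg_neg, add_comm]

/-- The Bessel potentials of orders `2` and `-2` are mutually inverse, and `H²` consists of the `u`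
whose order `2` potential is in `L²`. The equations are checked in the tempered distributions, where
`L²` embeds injectively. -/
theorem isResolventAt_besselOp :
    IsResolventAt negLaplacian ((-fourPiSq : ℝ) : ℂ) ((fourPiSq : ℂ)⁻¹ • besselOp) := by
  have hc : (fourPiSq : ℂ) ≠ 0 := Complex.ofReal_ne_zero.mpr fourPiSq_pos.ne'
  have key : ∀ (u : negLaplacian.domain),
      toDist (negLaplacian u - ((-fourPiSq : ℝ) : ℂ) • (u : L2)) =
        (fourPiSq : ℂ) • besselPotential E3 ℂ 2 (toDist (u : L2)) := by
    intro u
    rw [← neg_laplacian_add_eq, Complex.ofReal_neg, neg_smul, sub_neg_eq_add, map_add, map_smul,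
      toDist_negLaplacian]
  refine ⟨fun f => ?_, fun u => ?_⟩
  · have hb : toDist (((fourPiSq : ℂ)⁻¹ • besselOp) f) =
        (fourPiSq : ℂ)⁻¹ • besselPotential E3 ℂ (-2) (toDist f) := by
      rw [smul_apply, map_smul, toDist_besselOp]
    have hb2 : besselPotential E3 ℂ 2 (toDist (((fourPiSq : ℂ)⁻¹ • besselOp) f)) =
        (fourPiSq : ℂ)⁻¹ • toDist f := by
      rw [hb, map_smul, besselPotential_besselPotential_apply]
      simp
    have hmem : ((fourPiSq : ℂ)⁻¹ • besselOp) f ∈ negLaplacian.domain := by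
      refine ⟨(fourPiSq : ℂ)⁻¹ • f, hb2.trans ?_⟩
      rw [← map_smul]
      rfl
    refine ⟨hmem, toDist_injective ?_⟩
    rw [key ⟨_, hmem⟩, hb2, smul_smul, mul_inv_cancel₀ hc, one_smul]
  · apply toDist_injective
    rw [smul_apply, map_smul, toDist_besselOp, key, map_smul,
      besselPotential_besselPotential_apply, smul_smul, inv_mul_cancel₀ hc, one_smul]
    simp

/-- Parametrizes the domain by `f = (-Δ + 4π²) u`, so that symmetry and nonnegativity of `-Δ` become
statements about a bounded operator. -/
theorem exists_eq_besselOp (u : negLaplacian.domain) :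
    ∃ f : L2, (u : L2) = (fourPiSq : ℂ)⁻¹ • besselOp f ∧ negLaplacian u = f - besselOp f := by
  have hc : (fourPiSq : ℂ) ≠ 0 := Complex.ofReal_ne_zero.mpr fourPiSq_pos.ne'
  have h := isResolventAt_besselOp.2 u
  refine ⟨negLaplacian u - ((-fourPiSq : ℝ) : ℂ) • (u : L2), h.symm, ?_⟩
  have h2 : besselOp (negLaplacian u - ((-fourPiSq : ℝ) : ℂ) • (u : L2)) =
      (fourPiSq : ℂ) • (u : L2) := by
    conv_rhs => rw [← h, smul_apply, smul_smul, mul_inv_cancel₀ hc, one_smul]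
  rw [h2, Complex.ofReal_neg, neg_smul]
  abel

theorem isSymm_negLaplacian : IsSymm negLaplacian := by
  intro u v
  obtain ⟨f, hf, hf'⟩ := exists_eq_besselOp u
  obtain ⟨g, hg, hg'⟩ := exists_eq_besselOp v
  rw [hf, hf', hg, hg', inner_smul_left, inner_smul_right, inner_sub_left, inner_sub_right,
    besselOp_symm f g, ← Complex.ofReal_inv, Complex.conj_ofReal]

theorem isNonneg_negLaplacian : IsNonneg negLaplacian := by
  intro u
  obtain ⟨f, hf, hf'⟩ := exists_eq_besselOp u
  rw [hf, hf', inner_smul_right, ← Complex.ofReal_inv, Complex.re_ofReal_mul, inner_sub_left,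
    Complex.sub_re]
  refine mul_nonneg (inv_nonneg.mpr fourPiSq_pos.le) (sub_nonneg.mpr ?_)
  refine le_of_eq_of_le ?_ (norm_besselOp_sq_le f)
  exact inner_self_eq_norm_sq (𝕜 := ℂ) _

theorem mem_resolventSetOf_negLaplacian {z : ℂ} (hz : ∀ t : ℝ, 0 ≤ t → z ≠ t) :
    z ∈ resolventSetOf negLaplacian :=
  isNonneg_negLaplacian.mem_resolventSetOf isSymm_negLaplacian fourPiSq_pos
    isResolventAt_besselOp hz

end Laplacian

/-! ### Null sets under differentiable maps -/

section NullSets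

variable {E F : Type*} [NormedAddCommGroup E] [NormedSpace ℝ E] [FiniteDimensional ℝ E]
  [MeasurableSpace E] [BorelSpace E] [NormedAddCommGroup F] [NormedSpace ℝ F]
  [MeasurableSpace F] [BorelSpace F]
  {μ : Measure E} [μ.IsAddHaarMeasure] {ν : Measure F} [ν.IsAddHaarMeasure]

/-- Haar measures on the same space have the same null sets. This identifies `E` with `F`, so that
results on maps from a space to itself apply. -/
theorem measure_continuousLinearEquiv_image_eq_zero_iff (L : F ≃L[ℝ] E) (s : Set F) :
    μ (L '' s) = 0 ↔ ν s = 0 := by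
  have : (ν.map L).IsAddHaarMeasure := L.isAddHaarMeasure_map ν
  have h1 : ν.map L (L '' s) = ν s := by
    have := L.toHomeomorph.toMeasurableEquiv.map_apply (μ := ν) (L '' s)
    rw [show (L.toHomeomorph.toMeasurableEquiv : F → E) = L from rfl,
      Set.preimage_image_eq _ L.injective] at this
    exact this
  rw [← h1]
  exact ⟨fun h => (Measure.absolutelyContinuous_isAddHaarMeasure (ν.map L) μ) h,
    fun h => (Measure.absolutelyContinuous_isAddHaarMeasure μ (ν.map L)) h⟩

/-- A differentiable map between spaces of the same dimension maps null sets to null sets. -/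
theorem measure_image_eq_zero_of_differentiableOn [FiniteDimensional ℝ F]
    (hdim : Module.finrank ℝ F = Module.finrank ℝ E) {f : E → F} {s : Set E}
    (hf : DifferentiableOn ℝ f s) (hs : μ s = 0) : ν (f '' s) = 0 := by
  have L : F ≃L[ℝ] E := ContinuousLinearEquiv.ofFinrankEq hdim
  rw [← measure_continuousLinearEquiv_image_eq_zero_iff (μ := μ) L, Set.image_image]
  exact addHaar_image_eq_zero_of_differentiableOn_of_addHaar_eq_zero μ
    (L.differentiable.comp_differentiableOn hf) hs

/-- A set is null if its image under an injective map with injective derivatives is null. -/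
theorem measure_eq_zero_of_measure_image_eq_zero [FiniteDimensional ℝ F]
    (hdim : Module.finrank ℝ F = Module.finrank ℝ E) {f : E → F} {f' : E → E →L[ℝ] F} {s : Set E}
    (hs : MeasurableSet s) (hf : ∀ x ∈ s, HasFDerivAt f (f' x) x)
    (hf' : ∀ x ∈ s, Function.Injective (f' x)) (hinj : Set.InjOn f s) (h0 : ν (f '' s) = 0) :
    μ s = 0 := by
  have L : F ≃L[ℝ] E := ContinuousLinearEquiv.ofFinrankEq hdim
  rw [← measure_continuousLinearEquiv_image_eq_zero_iff (μ := μ) L, Set.image_image] at h0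
  have hder : ∀ x ∈ s, HasFDerivWithinAt (fun x => L (f x)) ((L : F →L[ℝ] E) ∘L f' x) s x :=
    fun x hx => (L.hasFDerivAt.comp x (hf x hx)).hasFDerivWithinAt
  -- By the area formula the Jacobian integrates to the measure of the image, which is zero; but the
  -- Jacobian vanishes nowhere on `s`.
  have hintegral := lintegral_abs_det_fderiv_eq_addHaar_image μ hs hder (L.injective.injOn.comp hinj
    (Set.mapsTo_univ _ _))
  rw [h0] at hintegral
  have hmeas : AEMeasurable (fun x => ENNReal.ofReal |((L : F →L[ℝ] E) ∘L f' x).det|)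
      (μ.restrict s) := aemeasurable_ofReal_abs_det_fderivWithin μ hs hder
  have hae := (setLIntegral_eq_zero_iff' hs hmeas).mp hintegral
  refine measure_mono_null (fun x hx => ?_) (ae_iff.mp hae)
  simp only [Set.mem_ofPred_eq, Classical.not_imp]
  refine ⟨hx, ?_⟩
  rw [ENNReal.ofReal_eq_zero, not_le, abs_pos]
  intro hdet
  refine (LinearMap.bot_lt_ker_of_det_eq_zero hdet).ne' ?_
  rw [LinearMap.ker_eq_bot]
  exact L.injective.comp (hf' x hx)

end NullSets

/-! ### Geometry of the tube and the potential on it -/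

namespace Data

variable {D : Data}

/-- The coefficient of `n` in the tube map. -/
def coeffN (D : Data) (s : ℝ) (y : E2) : ℝ :=
  y 0 * Real.cos (D.α s) + y 1 * Real.sin (D.α s)

/-- The coefficient of `b` in the tube map. -/
def coeffB (D : Data) (s : ℝ) (y : E2) : ℝ :=
  y 1 * Real.cos (D.α s) - y 0 * Real.sin (D.α s)

/-- The factor by which the tube map stretches the longitudinal direction. -/
def stretch (D : Data) (p : ℝ × E2) : ℝ :=
  1 + D.γ p.1 * (D.coeffN p.1 p.2 * Real.cos (D.β p.1) + D.coeffB p.1 p.2 * Real.sin (D.β p.1))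

/-- The Tang condition `α' = τ` makes the rotation of the cross section cancel the torsion terms of
`n'` and `b'`, so the longitudinal derivative is parallel to the tangent. -/
theorem exists_hasFDerivAt_tubeMap (hD : D.Admissible) (p : ℝ × E2) :
    ∃ L : ℝ × E2 →L[ℝ] E3, HasFDerivAt D.tubeMap L p ∧ ∀ v : ℝ × E2,
      L v = (v.1 * D.stretch p) • deriv D.Γ p.1 -
        (D.coeffN p.1 v.2 • D.n p.1 + D.coeffB p.1 v.2 • D.b p.1) := by
  have hfst : HasFDerivAt (Prod.fst : ℝ × E2 → ℝ) (ContinuousLinearMap.fst ℝ ℝ E2) p :=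
    hasFDerivAt_fst
  have hcos : HasFDerivAt (fun p : ℝ × E2 => Real.cos (D.α p.1)) _ p :=
    ((hD.tang p.1).cos).comp_hasFDerivAt p hfst
  have hsin : HasFDerivAt (fun p : ℝ × E2 => Real.sin (D.α p.1)) _ p :=
    ((hD.tang p.1).sin).comp_hasFDerivAt p hfst
  have hy (i : Fin 2) : HasFDerivAt (fun p : ℝ × E2 => p.2 i)
      ((EuclideanSpace.proj i : E2 →L[ℝ] ℝ) ∘L ContinuousLinearMap.snd ℝ ℝ E2) p :=
    ((EuclideanSpace.proj i : E2 →L[ℝ] ℝ) ∘L ContinuousLinearMap.snd ℝ ℝ E2).hasFDerivAt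
  have hΓ : HasFDerivAt (fun p : ℝ × E2 => D.Γ p.1) _ p :=
    ((hD.contDiff.differentiable (by norm_num) p.1).hasDerivAt.hasFDerivAt).comp p hfst
  have hn : HasFDerivAt (fun p : ℝ × E2 => D.n p.1) _ p :=
    ((hD.frenet_n p.1).hasFDerivAt).comp p hfst
  have hb : HasFDerivAt (fun p : ℝ × E2 => D.b p.1) _ p :=
    ((hD.frenet_b p.1).hasFDerivAt).comp p hfst
  refine ⟨_, hΓ.sub (((((hy 0).mul hcos).add ((hy 1).mul hsin)).smul hn).add
    ((((hy 1).mul hcos).sub ((hy 0).mul hsin)).smul hb)), fun v => ?_⟩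
  simp [stretch, coeffN, coeffB]
  module

theorem differentiable_tubeMap (hD : D.Admissible) : Differentiable ℝ D.tubeMap := fun p =>
  (exists_hasFDerivAt_tubeMap hD p).choose_spec.1.differentiableAt

theorem injective_fderiv_tubeMap (hD : D.Admissible) {p : ℝ × E2} (hp : D.stretch p ≠ 0) :
    Function.Injective (fderiv ℝ D.tubeMap p) := by
  obtain ⟨L, hL, hv⟩ := exists_hasFDerivAt_tubeMap hD p
  rw [hL.fderiv, injective_iff_map_eq_zero]
  intro v h0
  rw [hv] at h0
  have hli := (hD.orthonormal p.1).linearIndependent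
  rw [Fintype.linearIndependent_iff] at hli
  have h := hli ![v.1 * D.stretch p, -D.coeffN p.1 v.2, -D.coeffB p.1 v.2] (by
    rw [← h0]
    simp [Fin.sum_univ_three]
    abel)
  have h1 : v.1 = 0 := by
    have : v.1 * D.stretch p = 0 := h 0
    exact (mul_eq_zero.mp this).resolve_right hp
  have h2 : D.coeffN p.1 v.2 = 0 := neg_eq_zero.mp (h 1)
  have h3 : D.coeffB p.1 v.2 = 0 := neg_eq_zero.mp (h 2)
  simp only [coeffN, coeffB] at h2 h3
  have hsc := Real.sin_sq_add_cos_sq (D.α p.1)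
  have h4 : v.2 0 = 0 := by
    linear_combination (Real.cos (D.α p.1)) * h2 - (Real.sin (D.α p.1)) * h3 - v.2 0 * hsc
  have h5 : v.2 1 = 0 := by
    linear_combination (Real.sin (D.α p.1)) * h2 + (Real.cos (D.α p.1)) * h3 - v.2 1 * hsc
  refine Prod.ext h1 ?_
  ext i
  fin_cases i
  · exact h4
  · exact h5

theorem eventually_curvature_small (hD : D.Admissible) {ε : ℝ} (hε : 0 < ε) :
    ∀ᶠ s in atTop, |D.γ s| < ε := by
  rcases hD.straight with ⟨s₀, hs₀, h⟩ | ⟨-, -, -, -, h, -⟩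
  · filter_upwards [eventually_gt_atTop s₀] with s hs
    rw [(h s (hs.trans_le (le_abs_self s))).1, abs_zero]
    exact hε
  · have := (h.mono_left atTop_le_cocompact).abs
    rw [abs_zero] at this
    exact this.eventually (gt_mem_nhds hε)

theorem exists_stretch_ne_zero (hD : D.Admissible) :
    ∃ S : ℝ, ∀ s ≥ S, ∀ y ∈ D.M, D.stretch (s, y) ≠ 0 := by
  obtain ⟨r, hr⟩ := (hD.precompact.isBounded.subset subset_closure).exists_norm_le
  obtain ⟨S, hS⟩ := eventually_atTop.mp
    -- Both cross-sectional coefficients are at most `2|r|`, so `γ` multiplies a quantity bounded by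
    -- `4|r|`. The `+ 1` makes the product strictly smaller than `1` and covers `r = 0`.
    (eventually_curvature_small hD (ε := (4 * |r| + 1)⁻¹) (by positivity))
  refine ⟨S, fun s hs y hy => ?_⟩
  have hγ := hS s hs
  have hyr : ‖y‖ ≤ |r| := (hr y hy).trans (le_abs_self r)
  have hyi : ∀ i, |y i| ≤ |r| := fun i => (PiLp.norm_apply_le y i).trans hyr
  have hmul : ∀ u v : ℝ, |v| ≤ 1 → |u * v| ≤ |u| := fun u v hv => by
    rw [abs_mul]; exact mul_le_of_le_one_right (abs_nonneg u) hv
  have hN : |D.coeffN s y| ≤ 2 * |r| := by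
    refine (abs_add_le _ _).trans ?_
    have h1 := (hmul (y 0) _ (Real.abs_cos_le_one (D.α s))).trans (hyi 0)
    have h2 := (hmul (y 1) _ (Real.abs_sin_le_one (D.α s))).trans (hyi 1)
    linarith
  have hB : |D.coeffB s y| ≤ 2 * |r| := by
    refine (abs_sub _ _).trans ?_
    have h1 := (hmul (y 1) _ (Real.abs_cos_le_one (D.α s))).trans (hyi 1)
    have h2 := (hmul (y 0) _ (Real.abs_sin_le_one (D.α s))).trans (hyi 0)
    linarith
  set q := D.coeffN s y * Real.cos (D.β s) + D.coeffB s y * Real.sin (D.β s) with hq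
  have hqle : |q| ≤ 4 * |r| := by
    refine (abs_add_le _ _).trans ?_
    have h1 := (hmul (D.coeffN s y) _ (Real.abs_cos_le_one (D.β s))).trans hN
    have h2 := (hmul (D.coeffB s y) _ (Real.abs_sin_le_one (D.β s))).trans hB
    linarith
  have hlt : |D.γ s * q| < 1 := by
    rw [abs_mul]
    have hpos : 0 < 4 * |r| + 1 := by positivity
    calc |D.γ s| * |q| ≤ (4 * |r| + 1)⁻¹ * (4 * |r|) := by gcongr
      _ < 1 := by rw [inv_mul_lt_one₀ hpos]; linarith
  intro h0
  have h0' : 1 + D.γ s * q = 0 := h0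
  have : D.γ s * q = -1 := by linarith
  rw [this] at hlt
  norm_num at hlt

theorem finrank_eq : Module.finrank ℝ E3 = Module.finrank ℝ (ℝ × E2) := by
  simp

instance isAddHaarMeasure_volume_prod : (volume : Measure (ℝ × E2)).IsAddHaarMeasure :=
  inferInstanceAs (((volume : Measure ℝ).prod (volume : Measure E2)).IsAddHaarMeasure)

theorem volume_tubeMap_image_prod_eq_zero (hD : D.Admissible) {N : Set E2} (hN : volume N = 0) :
    volume (D.tubeMap '' (Set.univ ×ˢ N)) = 0 := by
  refine measure_image_eq_zero_of_differentiableOn (μ := (volume : Measure (ℝ × E2))) finrank_eq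
    (differentiable_tubeMap hD).differentiableOn ?_
  rw [Measure.volume_eq_prod, Measure.prod_prod, hN, mul_zero]

theorem potential_tubeMap (hD : D.Admissible) {q : ℝ × E2} (hq : q.2 ∈ D.M) :
    D.potential (D.tubeMap q) = D.V q.2 := by
  have hex : ∃ q' : ℝ × E2, q'.2 ∈ D.M ∧ D.tubeMap q' = D.tubeMap q := ⟨q, hq, rfl⟩
  rw [potential, dif_pos hex]
  congr 2
  exact hD.injOn ⟨trivial, hex.choose_spec.1⟩ ⟨trivial, hq⟩ hex.choose_spec.2

theorem potential_of_notMem {x : E3} (hx : x ∉ D.tubeMap '' (Set.univ ×ˢ D.M)) :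
    D.potential x = 0 := by
  rw [potential, dif_neg]
  rintro ⟨q, hq, rfl⟩
  exact hx ⟨q, ⟨trivial, hq⟩, rfl⟩

/-- A property that holds for almost all values of the profile (and for `0`) holds for almost all
values of the potential. -/
theorem ae_potential (hD : D.Admissible) {P : ℝ → Prop} (h0 : P 0) (hP : ∀ᵐ y, P (D.V y)) :
    ∀ᵐ x, P (D.potential x) := by
  refine measure_mono_null (fun x hx => ?_) (volume_tubeMap_image_prod_eq_zero hD (ae_iff.mp hP))
  by_cases hxt : x ∈ D.tubeMap '' (Set.univ ×ˢ D.M)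
  · obtain ⟨q, ⟨-, hq⟩, rfl⟩ := hxt
    refine ⟨q, ⟨trivial, fun h => hx ?_⟩, rfl⟩
    change P (D.potential (D.tubeMap q))
    rwa [potential_tubeMap hD hq]
  · exact absurd (show P (D.potential x) by rwa [potential_of_notMem hxt]) hx

/-- An injective continuous map on a Borel set is a measurable embedding, so a measurable
representative of the profile, extended by zero off the tube, is measurable. Passing to the
representative changes the potential only on the image of a null set. -/
theorem aestronglyMeasurable_potential (hD : D.Admissible) :
    AEStronglyMeasurable D.potential (volume : Measure E3) := by
  set V' := hD.memLp.1.mk D.V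
  have hV' : Measurable V' := hD.memLp.1.stronglyMeasurable_mk.measurable
  have hae : ∀ᵐ y, D.V y = V' y := hD.memLp.1.ae_eq_mk
  have hemb : MeasurableEmbedding ((Set.univ ×ˢ D.M).domRestrict D.tubeMap) :=
    (differentiable_tubeMap hD).continuous.continuousOn.measurableEmbedding
      (MeasurableSet.univ.prod hD.isOpen.measurableSet) hD.injOn
  have hmeas := hemb.measurable_extend (g := fun q => V' (q : ℝ × E2).2)
    (g' := fun _ => (0 : ℝ)) (hV'.comp (measurable_snd.comp measurable_subtype_coe))
    measurable_const
  refine ⟨_, hmeas.stronglyMeasurable, ?_⟩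
  refine measure_mono_null (fun x hx => ?_) (volume_tubeMap_image_prod_eq_zero hD (ae_iff.mp hae))
  by_cases hxt : x ∈ D.tubeMap '' (Set.univ ×ˢ D.M)
  · obtain ⟨q, hq, rfl⟩ := hxt
    refine ⟨q, ⟨trivial, fun h => hx ?_⟩, rfl⟩
    change D.potential (D.tubeMap q) = _
    rw [potential_tubeMap hD hq.2, h]
    exact (hemb.injective.extend_apply (fun q => V' (q : ℝ × E2).2) (fun _ => (0 : ℝ))
      ⟨q, hq⟩).symm
  · refine absurd ?_ hx
    change D.potential x = _
    rw [potential_of_notMem hxt, Function.extend_apply']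
    rintro ⟨q, rfl⟩
    exact hxt ⟨q, q.2, rfl⟩

theorem potential_nonneg (hD : D.Admissible) : 0 ≤ᵐ[volume] D.potential :=
  ae_potential hD (P := fun t => 0 ≤ t) le_rfl hD.nonneg

theorem ae_enorm_potential_le (hD : D.Admissible) :
    ∀ᵐ x, ‖D.potential x‖ₑ ≤ eLpNorm D.V ∞ volume :=
  ae_potential hD (P := fun t => ‖t‖ₑ ≤ eLpNorm D.V ∞ volume) (by simp) (by
    rw [eLpNorm_exponent_top]
    exact enorm_ae_le_eLpNormEssSup D.V volume)

theorem eLpNorm_potential_le (hD : D.Admissible) :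
    eLpNorm D.potential ∞ volume ≤ eLpNorm D.V ∞ volume := by
  conv_lhs => rw [eLpNorm_exponent_top]
  exact eLpNormEssSup_le_of_ae_enorm_bound (ae_enorm_potential_le hD)

theorem memLp_potential (hD : D.Admissible) : MemLp D.potential ∞ volume :=
  ⟨aestronglyMeasurable_potential hD, (eLpNorm_potential_le hD).trans_lt hD.memLp.2⟩

/-- This supplies strictness in the operator order. If the potential vanished a.e., the image of
`[S, ∞) × B`, with `B` the part of `M` where the representative of the profile is nonzero, would be
null. On that set the derivative of the tube map is injective, so the product is null, and the
infinite length of `[S, ∞)` forces `B` to be null. -/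
theorem potential_ne_zero (hD : D.Admissible) : ¬ D.potential =ᵐ[volume] 0 := by
  intro hzero
  set V' := hD.memLp.1.mk D.V
  have hV' : Measurable V' := hD.memLp.1.stronglyMeasurable_mk.measurable
  have hae : ∀ᵐ y, D.V y = V' y := hD.memLp.1.ae_eq_mk
  obtain ⟨S, hS⟩ := exists_stretch_ne_zero hD
  set B : Set E2 := {y | y ∈ D.M ∧ V' y ≠ 0}
  have hB : MeasurableSet B :=
    hD.isOpen.measurableSet.inter (hV' (measurableSet_singleton 0).compl)
  have himg : volume (D.tubeMap '' (Set.Ici S ×ˢ B)) = 0 := by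
    refine measure_mono_null ?_ (measure_union_null
      (volume_tubeMap_image_prod_eq_zero hD (ae_iff.mp hae)) (ae_iff.mp hzero))
    rintro _ ⟨q, ⟨-, hq⟩, rfl⟩
    by_cases h : D.V q.2 = V' q.2
    · right
      change ¬ D.potential (D.tubeMap q) = 0
      rw [potential_tubeMap hD hq.1, h]
      exact hq.2
    · left
      exact ⟨q, ⟨trivial, h⟩, rfl⟩
  have hnull := measure_eq_zero_of_measure_image_eq_zero (μ := (volume : Measure (ℝ × E2)))
    (ν := (volume : Measure E3)) (s := Set.Ici S ×ˢ B) finrank_eq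
    (f' := fun p => fderiv ℝ D.tubeMap p) (measurableSet_Ici.prod hB)
    (fun p _ => (differentiable_tubeMap hD p).hasFDerivAt)
    (fun p hp => injective_fderiv_tubeMap hD (hS p.1 hp.1 p.2 hp.2.1))
    (hD.injOn.mono (Set.prod_mono (Set.subset_univ _) fun _ hy => hy.1)) himg
  rw [Measure.volume_eq_prod, Measure.prod_prod, Real.volume_Ici, mul_eq_zero] at hnull
  have hB0 : volume B = 0 := hnull.resolve_left ENNReal.top_ne_zero
  refine hD.nonzero ?_
  filter_upwards [hae, hD.support, measure_eq_zero_iff_ae_notMem.mp hB0] with y h1 h2 h3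
  by_cases hy : y ∈ D.M
  · by_contra h
    exact h3 ⟨hy, fun h' => h (h1.trans h')⟩
  · exact h2 hy

end Data

/-- A bounded function whose multiplication operator vanishes is zero almost everywhere. -/
theorem ae_eq_zero_of_mulOp_eq_zero {g : E3 → ℝ} (hg : MemLp g ∞ volume)
    (h : ∀ f : L2, mulOp g f = 0) : g =ᵐ[volume] 0 := by
  -- Constants are not in `L²`, so the operator is tested on indicators of balls exhausting the
  -- space.
  have hball : ∀ k : ℕ, volume (Metric.ball (0 : E3) k) ≠ ∞ := fun k => measure_ball_lt_top.ne
  have hae : ∀ k : ℕ, ∀ᵐ x, x ∈ Metric.ball (0 : E3) k → g x = 0 := by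
    intro k
    set f : L2 := indicatorConstLp 2 measurableSet_ball (hball k) (1 : ℂ)
    have h0 := h f
    filter_upwards [mulOp_coeFn hg f, indicatorConstLp_coeFn (p := 2) (μ := volume)
      (hs := measurableSet_ball) (hμs := hball k) (c := (1 : ℂ)),
      Lp.coeFn_zero ℂ 2 (volume : Measure E3)] with x h1 h2 h3 hx
    rw [h0, h3, h2, Set.indicator_of_mem hx, mul_one] at h1
    exact Complex.ofReal_eq_zero.mp h1.symm
  filter_upwards [ae_all_iff.mpr hae] with x hx
  obtain ⟨k, hk⟩ := exists_nat_gt ‖x‖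
  exact hx k (mem_ball_zero_iff.mpr hk)

theorem not_nonneg_of_neg_sq {κ : ℝ} (hκ : 0 < κ) (t : ℝ) (ht : 0 ≤ t) : (-(κ : ℂ) ^ 2) ≠ t := by
  intro h
  have : -κ ^ 2 = t := by exact_mod_cast h
  nlinarith

theorem isResolventAt_negLaplacian_neg_sq {κ : ℝ} (hκ : 0 < κ) :
    IsResolventAt negLaplacian ((-(κ ^ 2) : ℝ) : ℂ) (resolventOf negLaplacian (-(κ : ℂ) ^ 2)) := by
  have h := isResolventAt_resolventOf
    (mem_resolventSetOf_negLaplacian (not_nonneg_of_neg_sq hκ))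
  have e : ((-(κ ^ 2) : ℝ) : ℂ) = -(κ : ℂ) ^ 2 := by push_cast; ring
  rwa [e]

/-! ### The Birman–Schwinger operator of the waveguide -/

namespace Data

variable {D : Data}

theorem memLp_sqrt_potential (hD : D.Admissible) :
    MemLp (fun x => √(D.potential x)) ∞ (volume : Measure E3) := by
  refine memLp_top_of_bound
    (Real.continuous_sqrt.comp_aestronglyMeasurable (aestronglyMeasurable_potential hD))
    (√(eLpNorm D.V ∞ volume).toReal) ?_
  filter_upwards [ae_enorm_potential_le hD] with x hx
  rw [Real.norm_of_nonneg (Real.sqrt_nonneg _)]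
  refine Real.sqrt_le_sqrt ((le_abs_self _).trans ?_)
  rw [← Real.norm_eq_abs, ← toReal_enorm]
  exact ENNReal.toReal_mono hD.memLp.2.ne hx

theorem isSelfAdjoint_sqrtPotentialOp (hD : D.Admissible) : IsSelfAdjoint D.sqrtPotentialOp :=
  isSelfAdjoint_mulOp (memLp_sqrt_potential hD)

theorem sqrtPotentialOp_mul_self (hD : D.Admissible) :
    D.sqrtPotentialOp * D.sqrtPotentialOp = mulOp D.potential :=
  mulOp_mul_mulOp (memLp_sqrt_potential hD) (memLp_sqrt_potential hD) (memLp_potential hD)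
    ((potential_nonneg hD).mono fun _ hx => Real.mul_self_sqrt hx)

/-- The C*-identity turns the squared norm into the norm of multiplication by the potential itself.
-/
theorem norm_sqrtPotentialOp_sq_le (hD : D.Admissible) :
    ‖D.sqrtPotentialOp‖ * ‖D.sqrtPotentialOp‖ ≤ (eLpNorm D.V ∞ volume).toReal := by
  have h := CStarRing.norm_star_mul_self (x := D.sqrtPotentialOp)
  rw [(isSelfAdjoint_sqrtPotentialOp hD).star_eq, sqrtPotentialOp_mul_self hD] at h
  rw [← h]
  exact (norm_mulOp_le (memLp_potential hD)).trans
    (ENNReal.toReal_mono hD.memLp.2.ne (eLpNorm_potential_le hD))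

theorem exists_sqrtPotentialOp_ne_zero (hD : D.Admissible) : ∃ ψ, D.sqrtPotentialOp ψ ≠ 0 := by
  by_contra! h
  refine potential_ne_zero hD ?_
  filter_upwards [ae_eq_zero_of_mulOp_eq_zero (memLp_sqrt_potential hD) h, potential_nonneg hD]
    with x h1 h2
  exact (Real.sqrt_eq_zero h2).mp h1

theorem birmanSchwinger_eq (z : ℂ) :
    D.birmanSchwinger z = D.sqrtPotentialOp * resolventOf negLaplacian z * D.sqrtPotentialOp := rfl

theorem inner_birmanSchwinger (hD : D.Admissible) (z : ℂ) (ψ : L2) :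
    inner ℂ ψ (D.birmanSchwinger z ψ) =
      inner ℂ (D.sqrtPotentialOp ψ) (resolventOf negLaplacian z (D.sqrtPotentialOp ψ)) :=
  ((isSelfAdjoint_sqrtPotentialOp hD).isSymmetric _ _).symm

theorem isSelfAdjoint_birmanSchwinger (hD : D.Admissible) {κ : ℝ} (hκ : 0 < κ) :
    IsSelfAdjoint (D.birmanSchwinger (-(κ : ℂ) ^ 2)) := by
  have hR := isSymm_negLaplacian.isSelfAdjoint_resolvent (isResolventAt_negLaplacian_neg_sq hκ)
  have h := hR.conjugate D.sqrtPotentialOp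
  rwa [(isSelfAdjoint_sqrtPotentialOp hD).star_eq] at h

theorem mem_discreteSpectrum_hamiltonian_iff (hD : D.Admissible) {z : ℂ}
    (hz : ∀ t : ℝ, 0 ≤ t → z ≠ t) :
    z ∈ discreteSpectrum D.hamiltonian ↔
      (1 : ℂ) ∈ discreteSpectrum (ofBounded (D.birmanSchwinger z)) := by
  have h := birmanSchwinger_principle isNonneg_negLaplacian isSymm_negLaplacian
    (fun _ => mem_resolventSetOf_negLaplacian) (isSelfAdjoint_sqrtPotentialOp hD) hz
  rwa [sqrtPotentialOp_mul_self hD] at h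

theorem re_inner_birmanSchwinger_lt (hD : D.Admissible) {κ₁ κ₂ : ℝ} (h₁ : 0 < κ₁) (h₂ : κ₁ < κ₂)
    {ψ : L2} (hψ : D.sqrtPotentialOp ψ ≠ 0) :
    (inner ℂ ψ (D.birmanSchwinger (-(κ₂ : ℂ) ^ 2) ψ)).re <
      (inner ℂ ψ (D.birmanSchwinger (-(κ₁ : ℂ) ^ 2) ψ)).re := by
  rw [inner_birmanSchwinger hD, inner_birmanSchwinger hD]
  exact isNonneg_negLaplacian.re_inner_resolvent_lt isSymm_negLaplacian (pow_pos h₁ 2)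
    (pow_lt_pow_left₀ h₂ h₁.le two_ne_zero) (isResolventAt_negLaplacian_neg_sq h₁)
    (isResolventAt_negLaplacian_neg_sq (h₁.trans h₂)) hψ

theorem strictAntiOn_birmanSchwinger (hD : D.Admissible) :
    StrictAntiOn (fun κ : ℝ => D.birmanSchwinger (-(κ : ℂ) ^ 2)) (Set.Ioi 0) := by
  intro κ₁ h₁ κ₂ h₂ h
  have h₁' : 0 < κ₁ := h₁
  have h₂' : 0 < κ₂ := h₂
  refine lt_of_le_of_ne ?_ fun heq => ?_
  · rw [ContinuousLinearMap.le_def, ContinuousLinearMap.isPositive_def']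
    refine ⟨(isSelfAdjoint_birmanSchwinger hD h₁').sub (isSelfAdjoint_birmanSchwinger hD h₂'),
      fun ψ => ?_⟩
    rw [ContinuousLinearMap.reApplyInnerSelf_apply, ← inner_conj_symm, RCLike.conj_re, sub_apply,
      inner_sub_right, map_sub, sub_nonneg]
    -- Vectors killed by the square root of the potential give zero for both forms; all others give
    -- the strict inequality.
    by_cases hψ : D.sqrtPotentialOp ψ = 0
    · rw [inner_birmanSchwinger hD, inner_birmanSchwinger hD, hψ, inner_zero_left, inner_zero_left]
    · exact (re_inner_birmanSchwinger_lt hD h₁' h hψ).le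
  · obtain ⟨ψ, hψ⟩ := exists_sqrtPotentialOp_ne_zero hD
    have hlt := re_inner_birmanSchwinger_lt hD h₁' h hψ
    simp only at heq
    rw [heq] at hlt
    exact lt_irrefl _ hlt

/-- By the resolvent identity the resolvents at `-κ²` and `-κ'²` differ in norm by at most `|κ² -
κ'²| κ'⁻² κ⁻²`. -/
theorem continuousOn_birmanSchwinger (D : Data) :
    ContinuousOn (fun κ : ℝ => D.birmanSchwinger (-(κ : ℂ) ^ 2)) (Set.Ioi 0) := by
  have hres : ContinuousOn (fun κ : ℝ => resolventOf negLaplacian (-(κ : ℂ) ^ 2)) (Set.Ioi 0) := by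
    intro κ hκ
    have hκ' : 0 < κ := hκ
    rw [ContinuousWithinAt, tendsto_iff_norm_sub_tendsto_zero]
    have hbound : Tendsto (fun κ' : ℝ => |κ ^ 2 - κ' ^ 2| * ((κ' ^ 2)⁻¹ * (κ ^ 2)⁻¹))
        (𝓝[Set.Ioi 0] κ) (𝓝 0) := by
      have hc : ContinuousAt (fun κ' : ℝ => |κ ^ 2 - κ' ^ 2| * ((κ' ^ 2)⁻¹ * (κ ^ 2)⁻¹)) κ := by
        have : ContinuousAt (fun κ' : ℝ => (κ' ^ 2)⁻¹) κ :=
          ContinuousAt.inv₀ (by fun_prop) (by positivity)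
        fun_prop
      have := hc.tendsto
      simp only [sub_self, abs_zero, zero_mul] at this
      exact this.mono_left nhdsWithin_le_nhds
    refine squeeze_zero' (Eventually.of_forall fun _ => norm_nonneg _) ?_ hbound
    filter_upwards [self_mem_nhdsWithin] with κ' hκ''
    have hκ2 : 0 < κ' := hκ''
    have hR := isResolventAt_negLaplacian_neg_sq hκ'
    have hR' := isResolventAt_negLaplacian_neg_sq hκ2
    rw [hR'.sub_eq hR, norm_smul, ← Complex.ofReal_sub, Complex.norm_real, Real.norm_eq_abs]
    have e : -(κ' ^ 2) - -(κ ^ 2) = κ ^ 2 - κ' ^ 2 := by ring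
    rw [e]
    refine mul_le_mul_of_nonneg_left ((norm_mul_le _ _).trans ?_) (abs_nonneg _)
    exact mul_le_mul (isNonneg_negLaplacian.norm_resolvent_le (pow_pos hκ2 2) hR')
      (isNonneg_negLaplacian.norm_resolvent_le (pow_pos hκ' 2) hR) (norm_nonneg _) (by positivity)
  exact (continuousOn_const.mul hres).mul continuousOn_const

theorem norm_birmanSchwinger_le (hD : D.Admissible) {κ : ℝ} (hκ : 0 < κ) :
    ‖D.birmanSchwinger (-(κ : ℂ) ^ 2)‖ ≤ (κ ^ 2)⁻¹ * (eLpNorm D.V ∞ volume).toReal := by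
  have h1 := isNonneg_negLaplacian.norm_resolvent_le (pow_pos hκ 2)
    (isResolventAt_negLaplacian_neg_sq hκ)
  have h2 := norm_sqrtPotentialOp_sq_le hD
  rw [birmanSchwinger_eq]
  calc _ ≤ ‖D.sqrtPotentialOp‖ * ‖resolventOf negLaplacian (-(κ : ℂ) ^ 2)‖ *
        ‖D.sqrtPotentialOp‖ := norm_mul₃_le
    _ = ‖resolventOf negLaplacian (-(κ : ℂ) ^ 2)‖ *
        (‖D.sqrtPotentialOp‖ * ‖D.sqrtPotentialOp‖) := by ring
    _ ≤ _ := mul_le_mul h1 h2 (by positivity) (by positivity)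

theorem tendsto_norm_birmanSchwinger (hD : D.Admissible) :
    Tendsto (fun κ : ℝ => ‖D.birmanSchwinger (-(κ : ℂ) ^ 2)‖) atTop (𝓝 0) := by
  have h : Tendsto (fun κ : ℝ => (κ ^ 2)⁻¹ * (eLpNorm D.V ∞ volume).toReal) atTop (𝓝 0) := by
    have := ((tendsto_pow_atTop (α := ℝ) two_ne_zero).inv_tendsto_atTop).mul_const
      (eLpNorm D.V ∞ volume).toReal
    simpa using this
  refine squeeze_zero' (Eventually.of_forall fun _ => norm_nonneg _) ?_ h
  filter_upwards [eventually_gt_atTop 0] with κ hκ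
  exact norm_birmanSchwinger_le hD hκ

end Data

end SoftWaveguide

end

theorem proposition4p2 (D : SoftWaveguide.Data) (hD : D.Admissible) :
    -- the potential is bounded, so that the operators below are the intended ones
    MemLp D.potential ∞ volume ∧
    -- the Birman–Schwinger principle
    (∀ z : ℂ, (∀ t : ℝ, 0 ≤ t → z ≠ (t : ℂ)) →
      z ∈ SoftWaveguide.resolventSetOf SoftWaveguide.negLaplacian ∧
      (z ∈ SoftWaveguide.discreteSpectrum D.hamiltonian ↔
        (1 : ℂ) ∈ SoftWaveguide.discreteSpectrum
          (SoftWaveguide.ofBounded (D.birmanSchwinger z)))) ∧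
    -- continuity in the operator norm
    ContinuousOn (fun κ : ℝ => D.birmanSchwinger (-(κ : ℂ) ^ 2)) (Set.Ioi 0) ∧
    -- monotonicity in the order of bounded self-adjoint operators, and strictly in the form sense
    StrictAntiOn (fun κ : ℝ => D.birmanSchwinger (-(κ : ℂ) ^ 2)) (Set.Ioi 0) ∧
    (∀ κ₁ κ₂ : ℝ, 0 < κ₁ → κ₁ < κ₂ → ∀ ψ : SoftWaveguide.L2, D.sqrtPotentialOp ψ ≠ 0 →
      (inner ℂ ψ (D.birmanSchwinger (-(κ₂ : ℂ) ^ 2) ψ)).re <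
        (inner ℂ ψ (D.birmanSchwinger (-(κ₁ : ℂ) ^ 2) ψ)).re) ∧
    -- the norm bound and the limit
    (∀ κ : ℝ, 0 < κ →
      ‖D.birmanSchwinger (-(κ : ℂ) ^ 2)‖ ≤ (κ ^ 2)⁻¹ * (eLpNorm D.V ∞ volume).toReal) ∧
    Tendsto (fun κ : ℝ => ‖D.birmanSchwinger (-(κ : ℂ) ^ 2)‖) atTop (𝓝 0) := by
  exact ⟨SoftWaveguide.Data.memLp_potential hD,
    fun z hz => ⟨SoftWaveguide.mem_resolventSetOf_negLaplacian hz,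
      SoftWaveguide.Data.mem_discreteSpectrum_hamiltonian_iff hD hz⟩,
    D.continuousOn_birmanSchwinger, SoftWaveguide.Data.strictAntiOn_birmanSchwinger hD,
    fun _ _ h₁ h₂ _ hψ => SoftWaveguide.Data.re_inner_birmanSchwinger_lt hD h₁ h₂ hψ,
    fun _ hκ => SoftWaveguide.Data.norm_birmanSchwinger_le hD hκ, D.tendsto_norm_birmanSchwinger hD⟩
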